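/- Let $r,T>0$, $X=\mathbb R\times L^2([-r,0],\mathbb R)$ with its usual Hilbert structure, $a_0\le 0$, $b_0\ge 0$, $\sigma\in\mathbb R$, $a_1,b_1\in L^2([-r,0],\mathbb R)$ with $b_1\ge0$ a.e., and let $U\subseteq[0,\infty)$ be a nonempty compact interval. Let $\varphi_0:\mathbb R\to\mathbb R$ and $h_0:[0,\infty)\to[0,\infty)$ be measurable with $|\varphi_0(x)|\le K(1+|x|)^m$ for all $x\in\mathbb R$ and $|h_0(u)|\le K$ for all $u\in U$, for some $K>0$, $m\ge0$. Let $W_0$ be a standard real Brownian motion on a probability space, with completed filtration $\mathbb F$, and let $\mathcal U$ be the set of (measurable) $\mathbb F$-adapted processes on $[0,T]$ with values in $U$. For $x,x'\in X$ write $x\le x'$ if $x_0\le x'_0$ and $x_1\le x'_1$ a.e. Let $A(x_0,x_1)=(a_0x_0+x_1(0),\,a_1x_0-x_1')$ with $D(A)=\{x\in X: x_1\in W^{1,2}([-r,0]),\ x_1(-r)=0\}$, $Bu=(b_0u,b_1u)$, $Gw=(\sigma w,0)$. For $s\in[0,T]$, $x\in X$ and $z\in\mathcal U$ let $Y^{s,x,z}$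 be the weak solution on $[s,T]$ of $$dY(t)=(AY(t)+Bz(t))\,dt+G\,dW_0(t),\qquad Y(s)=x,$$ and let $$V(s,x)=\sup_{z\in\mathcal U}\mathbb E\Big[\varphi_0\big(Y_0^{s,x,z}(T)\big)-\int_s^T h_0(z(t))\,dt\Big].$$ For $\delta\in L^2([-r,0],\mathbb R)$ let also $V^\delta(s,x)$ be the same supremum with $Y_0^{s,x,z}(T)$ replaced by $y(T)$, where $y$ is the continuous adapted solution on $[s,T]$ of the controlled delay equation $$dy(t)=\Big[a_0y(t)+\int_{-r}^0a_1(\xi)y(t+\xi)\,d\xi+b_0z(t)+\int_{-r}^0b_1(\xi)z(t+\xi)\,d\xi\Big]dt+\sigma\,dW_0(t)$$ with $y(s)=x_0$ and $y(s+\xi)=x_1(\xi)$, $z(s+\xi)=\delta(\xi)$ for $\xi\in[-r,0)$. Suppose that $a_1\ge0$ a.e. and that $\varphi_0$ is increasing (in the weak sense). Then for every $s\in[0,T]$ the value function is increasing in $x$: if $x,x'\in X$ and $x\le x'$, then $V(s,x)\le V(s,x')$, and $V^\delta(s,x)\le V^\delta(s,x')$ for every $\delta\in L^2([-r,0],\mathbb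 R)$. -/

import Mathlib

open MeasureTheory ProbabilityTheory Set
open scoped NNReal ENNReal

noncomputable section

namespace Advertising

/-- The space `L²([-r,0], ℝ)`. -/
abbrev L2 (r : ℝ) : Type := Lp ℝ 2 (volume.restrict (Icc (-r) 0))

/-- The Hilbert space `X = ℝ × L²([-r,0], ℝ)`, with inner product
`⟪x, y⟫ = x₀ y₀ + ∫_{-r}^0 x₁ y₁`. -/
abbrev State (r : ℝ) : Type := WithLp 2 (ℝ × L2 r)

/-- The natural order on `X`: `x ≤ y` means `x₀ ≤ y₀` and `x₁ ≤ y₁` almost everywhere. -/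
def StateLE {r : ℝ} (x y : State r) : Prop :=
  x.fst ≤ y.fst ∧ ∀ᵐ ξ ∂(volume.restrict (Icc (-r) 0)), x.snd ξ ≤ y.snd ξ

/-- The data of the model, with the standing assumptions on them. The set of values of the
controls is the compact interval `U = [uMin, uMax] ⊆ [0, ∞)`; the values of the cost `h₀` outside
`[0, ∞)` are never used. -/
structure Model where
  /-- length of the memory -/
  r : ℝ
  /-- terminal time -/
  T : ℝ
  a₀ : ℝ
  /-- distributed forgetting -/
  a₁ : L2 r
  b₀ : ℝ
  /-- distributed effect of past advertising -/
  b₁ : L2 r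
  σ : ℝ
  uMin : ℝ
  uMax : ℝ
  /-- utility function -/
  φ₀ : ℝ → ℝ
  /-- cost function -/
  h₀ : ℝ → ℝ
  K : ℝ
  m : ℝ
  r_pos : 0 < r
  T_pos : 0 < T
  a₀_nonpos : a₀ ≤ 0
  b₀_nonneg : 0 ≤ b₀
  b₁_nonneg : ∀ᵐ ξ ∂(volume.restrict (Icc (-r) 0)), 0 ≤ b₁ ξ
  uMin_nonneg : 0 ≤ uMin
  uMin_le_uMax : uMin ≤ uMax
  φ₀_measurable : Measurable φ₀
  h₀_measurable : Measurable h₀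
  h₀_nonneg : ∀ u, 0 ≤ u → 0 ≤ h₀ u
  K_pos : 0 < K
  m_nonneg : 0 ≤ m
  φ₀_growth : ∀ x, |φ₀ x| ≤ K * (1 + |x|) ^ m
  h₀_bound : ∀ u ∈ Icc uMin uMax, |h₀ u| ≤ K

variable (M : Model)

/-! ### The operators of the abstract equation -/

lemma intervalIntegrable_of_L2 {r : ℝ} (g : L2 r) {ξ : ℝ} (hξ : ξ ∈ Icc (-r) 0) :
    IntervalIntegrable (fun ζ => g ζ) volume (-r) ξ := by
  have h1 : Integrable (fun ζ => g ζ) (volume.restrict (Icc (-r) 0)) :=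
    (Lp.memLp g).integrable (by norm_num)
  rw [intervalIntegrable_iff_integrableOn_Icc_of_le hξ.1]
  exact IntegrableOn.mono_set h1 (Icc_subset_Icc_right hξ.2)

lemma intervalIntegral_congr_L2 {r : ℝ} {g g' : ℝ → ℝ}
    (h : g =ᵐ[volume.restrict (Icc (-r) 0)] g') {ξ : ℝ} (hξ : ξ ∈ Icc (-r) 0) :
    ∫ ζ in (-r)..ξ, g ζ = ∫ ζ in (-r)..ξ, g' ζ := by
  rw [intervalIntegral.integral_of_le hξ.1, intervalIntegral.integral_of_le hξ.1]
  exact integral_congr_ae (ae_restrict_of_ae_restrict_of_subset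
    (Ioc_subset_Icc_self.trans (Icc_subset_Icc_right hξ.2)) h)

/-- The graph of the unbounded operator
`A (x₀, x₁) = (a₀ x₀ + x₁(0), a₁ x₀ - x₁')` on `X`, whose domain consists of the `x` with
`x₁ ∈ W^{1,2}([-r,0])` and `x₁(-r) = 0`. The latter means that `x₁` has the absolutely continuous
representative `ξ ↦ ∫_{-r}^ξ g` for some `g ∈ L²`; then `x₁' = g` and `x₁(0) = ∫_{-r}^0 g`. -/
def generatorGraph : Submodule ℝ (State M.r × State M.r) where
  carrier := {p | ∃ g : L2 M.r,
    (∀ᵐ ξ ∂(volume.restrict (Icc (-M.r) 0)), p.1.snd ξ = ∫ ζ in (-M.r)..ξ, g ζ) ∧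
    p.2.fst = M.a₀ * p.1.fst + ∫ ζ in (-M.r)..0, g ζ ∧
    p.2.snd = p.1.fst • M.a₁ - g}
  zero_mem' := by
    refine ⟨0, ?_, ?_, by simp⟩
    · filter_upwards [Lp.coeFn_zero ℝ 2 (volume.restrict (Icc (-M.r) 0)),
        ae_restrict_mem measurableSet_Icc] with ξ h hξ
      have := intervalIntegral_congr_L2
        (Lp.coeFn_zero ℝ 2 (volume.restrict (Icc (-M.r) 0))) hξ
      rw [this]
      simpa using h
    · have := intervalIntegral_congr_L2 (ξ := 0)
        (Lp.coeFn_zero ℝ 2 (volume.restrict (Icc (-M.r) 0))) ⟨by linarith [M.r_pos], le_rfl⟩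
      rw [this]
      simp
  add_mem' := by
    rintro p q ⟨g, h1, h2, h3⟩ ⟨g', h1', h2', h3'⟩
    have key : ∀ ξ ∈ Icc (-M.r) 0, ∫ ζ in (-M.r)..ξ, (g + g' : L2 M.r) ζ
        = (∫ ζ in (-M.r)..ξ, g ζ) + ∫ ζ in (-M.r)..ξ, g' ζ := by
      intro ξ hξ
      rw [intervalIntegral_congr_L2 (Lp.coeFn_add g g') hξ, ← intervalIntegral.integral_add
        (intervalIntegrable_of_L2 g hξ) (intervalIntegrable_of_L2 g' hξ)]
      rfl
    refine ⟨g + g', ?_, ?_, ?_⟩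
    · filter_upwards [h1, h1', Lp.coeFn_add p.1.snd q.1.snd,
        ae_restrict_mem measurableSet_Icc] with ξ e1 e2 e3 hξ
      rw [key ξ hξ, ← e1, ← e2]
      exact e3
    · rw [key 0 ⟨by linarith [M.r_pos], le_rfl⟩]
      simp only [Prod.snd_add, Prod.fst_add, WithLp.add_fst, h2, h2']
      ring
    · simp only [Prod.snd_add, Prod.fst_add, WithLp.add_fst, WithLp.add_snd, h3, h3', add_smul]
      abel
  smul_mem' := by
    rintro c p ⟨g, h1, h2, h3⟩
    have key : ∀ ξ ∈ Icc (-M.r) 0, ∫ ζ in (-M.r)..ξ, (c • g : L2 M.r) ζ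
        = c * ∫ ζ in (-M.r)..ξ, g ζ := by
      intro ξ hξ
      rw [intervalIntegral_congr_L2 (Lp.coeFn_smul c g) hξ, ← intervalIntegral.integral_const_mul]
      rfl
    refine ⟨c • g, ?_, ?_, ?_⟩
    · filter_upwards [h1, Lp.coeFn_smul c p.1.snd,
        ae_restrict_mem measurableSet_Icc] with ξ e1 e3 hξ
      rw [key ξ hξ, ← e1]
      exact e3
    · rw [key 0 ⟨by linarith [M.r_pos], le_rfl⟩]
      simp only [Prod.smul_snd, Prod.smul_fst, WithLp.smul_fst, h2, smul_eq_mul]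
      ring
    · simp only [Prod.smul_snd, Prod.smul_fst, WithLp.smul_fst, WithLp.smul_snd, h3, smul_sub,
        smul_eq_mul, mul_smul]

/-- The control operator `B u = (b₀ u, b₁ u)`. -/
def controlOp (u : ℝ) : State M.r := WithLp.toLp 2 (M.b₀ * u, u • M.b₁)

/-- The noise operator `G w = (σ w, 0)`. -/
def noiseOp (w : ℝ) : State M.r := WithLp.toLp 2 (M.σ * w, 0)

/-! ### Noise, filtration, controls -/

variable {Ω : Type*} [mΩ : MeasurableSpace Ω]

/-- The completion, by the `P`-null events, of the filtration generated by `W`. -/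
@[reducible]
def completedFiltration (P : Measure Ω) (W : ℝ≥0 → Ω → ℝ) (t : ℝ) : MeasurableSpace Ω :=
  (⨆ u : Iic t.toNNReal, MeasurableSpace.comap (W u) inferInstance) ⊔
    MeasurableSpace.generateFrom {N | MeasurableSet[mΩ] N ∧ P N = 0}

/-- The admissible controls: (jointly measurable) adapted processes on `[0, T]` with values
in `U`. -/
structure IsAdmissible (P : Measure Ω) (W : ℝ≥0 → Ω → ℝ) (z : ℝ → Ω → ℝ) : Prop where
  mem : ∀ t ∈ Icc 0 M.T, ∀ ω, z t ω ∈ Icc M.uMin M.uMax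
  measurable : Measurable (fun p : Icc (0 : ℝ) M.T × Ω => z p.1 p.2)
  adapted : ∀ t ∈ Icc 0 M.T, Measurable[completedFiltration P W t] (z t)

/-! ### The two state equations -/

/-- `Y` is a weak solution on `[s, T]` of `dY = (A Y + B z) dt + G dW`, `Y(s) = x`: an adapted
measurable `X`-valued process with almost surely integrable trajectories such that, for every `v`
in the domain of the adjoint `A*` and every `t ∈ [s, T]`, almost surely
`⟪Y(t), v⟫ = ⟪x, v⟫ + ∫_s^t (⟪Y(u), A* v⟫ + ⟪B z(u), v⟫) du + ⟪G (W(t) - W(s)), v⟫`. -/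
structure IsWeakSolution (P : Measure Ω) (W : ℝ≥0 → Ω → ℝ) (s : ℝ) (x : State M.r)
    (z : ℝ → Ω → ℝ) (Y : ℝ → Ω → State M.r) : Prop where
  adapted : ∀ t ∈ Icc s M.T, StronglyMeasurable[completedFiltration P W t] (Y t)
  measurable : StronglyMeasurable (fun p : Icc s M.T × Ω => Y p.1 p.2)
  integrable : ∀ᵐ ω ∂P, IntegrableOn (fun t => Y t ω) (Icc s M.T)
  initial : ∀ᵐ ω ∂P, Y s ω = x
  equation : ∀ v w : State M.r, (v, w) ∈ (generatorGraph M).adjoint → ∀ t ∈ Icc s M.T,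
    ∀ᵐ ω ∂P, inner ℝ (Y t ω) v = inner ℝ x v
      + (∫ u in s..t, (inner ℝ (Y u ω) w + inner ℝ (controlOp M (z u ω)) v))
      + inner ℝ (noiseOp M (W t.toNNReal ω - W s.toNNReal ω)) v

/-- The trajectory which equals `f` from time `s` on and has the history `past` before `s`:
its value at `s + ξ` is `past ξ` for `ξ < 0`. -/
def withHistory (s : ℝ) (past f : ℝ → ℝ) (t : ℝ) : ℝ := if t < s then past (t - s) else f t

/-- `y` is a continuous adapted solution on `[s, T]` of the stochastic delay equation
`dy(t) = [a₀ y(t) + ∫_{-r}^0 a₁(ξ) y(t+ξ) dξ + b₀ z(t) + ∫_{-r}^0 b₁(ξ) z(t+ξ) dξ] dt + σ dW(t)`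
with `y(s) = x₀`, `y(s+ξ) = x₁(ξ)` and `z(s+ξ) = δ(ξ)` for `ξ ∈ [-r, 0)`. -/
structure IsDelaySolution (P : Measure Ω) (W : ℝ≥0 → Ω → ℝ) (s : ℝ) (x : State M.r)
    (δ : L2 M.r) (z : ℝ → Ω → ℝ) (y : ℝ → Ω → ℝ) : Prop where
  adapted : ∀ t ∈ Icc s M.T, Measurable[completedFiltration P W t] (y t)
  continuous : ∀ᵐ ω ∂P, ContinuousOn (fun t => y t ω) (Icc s M.T)
  equation : ∀ᵐ ω ∂P, ∀ t ∈ Icc s M.T, y t ω = x.fst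
      + (∫ u in s..t, (M.a₀ * y u ω
          + (∫ ξ in (-M.r)..0, M.a₁ ξ * withHistory s x.snd (fun τ => y τ ω) (u + ξ))
          + M.b₀ * z u ω
          + ∫ ξ in (-M.r)..0, M.b₁ ξ * withHistory s δ (fun τ => z τ ω) (u + ξ)))
      + M.σ * (W t.toNNReal ω - W s.toNNReal ω)

/-! ### Objective functionals and value functions -/

/-- The expectation `E[ξ] = E[ξ⁺] - E[ξ⁻]`, as an extended real number. -/
def expectation (P : Measure Ω) (ξ : Ω → ℝ) : EReal :=
  ((∫⁻ ω, ENNReal.ofReal (ξ ω) ∂P : ℝ≥0∞) : EReal) -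
    ((∫⁻ ω, ENNReal.ofReal (-ξ ω) ∂P : ℝ≥0∞) : EReal)

lemma expectation_eq_integral {P : Measure Ω} {ξ : Ω → ℝ} (h : Integrable ξ P) :
    expectation P ξ = ((∫ ω, ξ ω ∂P : ℝ) : EReal) := by
  have h1 : ∫⁻ ω, ENNReal.ofReal (ξ ω) ∂P ≠ ∞ :=
    h.lintegral_lt_top.ne
  have h2 : ∫⁻ ω, ENNReal.ofReal (-ξ ω) ∂P ≠ ∞ := h.neg.lintegral_lt_top.ne
  rw [integral_eq_lintegral_pos_part_sub_lintegral_neg_part h, EReal.coe_sub, expectation,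
    EReal.coe_ennreal_toReal h1, EReal.coe_ennreal_toReal h2]

/-- The expected payoff `E[φ₀(η) - ∫_s^T h₀(z(t)) dt]` of the control `z` started at time `s`,
where `η` is the goodwill reached at time `T`. -/
def payoff (P : Measure Ω) (s : ℝ) (z : ℝ → Ω → ℝ) (η : Ω → ℝ) : EReal :=
  expectation P (fun ω => M.φ₀ (η ω) - ∫ t in s..M.T, M.h₀ (z t ω))

/-- The value function of the control problem on `X`:
`V(s,x) = sup_z E[φ(Y(T)) + ∫_s^T h(z(t)) dt]` with `φ(x₀, x₁) = φ₀(x₀)` and `h = -h₀`, where `Y`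
solves the abstract equation from `x` at time `s` with the control `z`. -/
def value (P : Measure Ω) (W : ℝ≥0 → Ω → ℝ) (s : ℝ) (x : State M.r) : EReal :=
  ⨆ (z : ℝ → Ω → ℝ) (_ : IsAdmissible M P W z)
    (Y : ℝ → Ω → State M.r) (_ : IsWeakSolution M P W s x z Y),
    payoff M P s z (fun ω => (Y M.T ω).fst)

/-- The value function of the control problem for the delay equation with the history `δ` of the
control: `V(s,x) = sup_z E[φ₀(y(T)) - ∫_s^T h₀(z(t)) dt]`, where `y` solves the delay equation with
initial datum `x` at time `s` and the control `z`. -/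
def delayValue (P : Measure Ω) (W : ℝ≥0 → Ω → ℝ) (δ : L2 M.r) (s : ℝ) (x : State M.r) : EReal :=
  ⨆ (z : ℝ → Ω → ℝ) (_ : IsAdmissible M P W z)
    (y : ℝ → Ω → ℝ) (_ : IsDelaySolution M P W s x δ z y),
    payoff M P s z (fun ω => y M.T ω)

end Advertising

end

namespace Advertising

open Filter

/-! ### Positive linear delay equations -/

/-! Both state equations are affine, so with the control, its history and the noise held fixed, two
solutions differ by a solution of the homogeneous deterministic equation started at `x' - x ≥ 0`. It
therefore suffices to build one such solution whose present component is nonnegative. Adding it to a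
given solution from `x` yields a solution from `x'` with the same control and at least the same
terminal goodwill (`IsDelaySolution.exists_ge`, `IsWeakSolution.exists_ge`). The payoff is monotone
in the goodwill (`payoff_mono`), and the suprema run over all controls and all solutions, so neither
uniqueness nor solvability of the noisy equations is needed.

Positivity comes from `a₁ ≥ 0`: once the instantaneous term is removed by an exponential factor, the
integrated delay equation is the fixed-point equation of a monotone map on `[0, ∞]`-valued
functions, solved by increasing Picard iterates (`exists_nonneg_delay_solution`).

For the abstract equation the homogeneous solution is explicit: the present component solves a delay
equation forced by the outflow of the initial memory at `ξ = 0`, and the memory component is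
`transport`. By `integral_transport` the time integral of the trajectory lies in the domain of the
generator, which maps it to the increment of the trajectory. Pairing with the adjoint gives the weak
equation (`exists_homogeneous_weakSolution`). -/

/-- The right-hand side of the integrated delay equation on `[s, ∞)` with nonnegative data,
as an operator on functions that vanish before `s`. -/
noncomputable def delayMap (s r : ℝ) (c : ℝ≥0∞) (a q v : ℝ → ℝ≥0∞) (t : ℝ) : ℝ≥0∞ :=
  if s ≤ t then c + ∫⁻ u in Ioc s t, ((∫⁻ α in Ioc (-r) 0, a α * v (u + α)) + q u) else 0

/-- The image is nondecreasing in time, so no measurability of `a`, `q` or `v` is required. -/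
lemma delayMap_measurable (s r : ℝ) (c : ℝ≥0∞) (a q v : ℝ → ℝ≥0∞) :
    Measurable (delayMap s r c a q v) := by
  refine Monotone.measurable fun t t' h => ?_
  unfold delayMap
  split_ifs with h1 h2
  · gcongr
  · exact absurd (h1.trans h) h2
  · simp
  · simp

lemma delayMap_mono (s r : ℝ) (c : ℝ≥0∞) (a q : ℝ → ℝ≥0∞) : Monotone (delayMap s r c a q) := by
  intro v v' h t
  unfold delayMap
  split_ifs
  · gcongr
    exact h _
  · exact le_rfl

lemma measurable_lag (r : ℝ) {a v : ℝ → ℝ≥0∞} (ha : Measurable a) (hv : Measurable v) :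
    Measurable fun u : ℝ => ∫⁻ α in Ioc (-r) 0, a α * v (u + α) :=
  Measurable.lintegral_prod_right' (f := fun p : ℝ × ℝ => a p.2 * v (p.1 + p.2)) (by fun_prop)

/-- Monotone convergence in the lag integral and again in the time integral. This continuity along
increasing sequences turns the supremum of the Picard iterates into a fixed point. -/
lemma delayMap_iSup (s r : ℝ) (c : ℝ≥0∞) {a q : ℝ → ℝ≥0∞} (ha : Measurable a)
    (hq : Measurable q) {v : ℕ → ℝ → ℝ≥0∞} (hv : ∀ n, Measurable (v n)) (hmono : Monotone v)
    (t : ℝ) :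
    delayMap s r c a q (fun τ => ⨆ n, v n τ) t = ⨆ n, delayMap s r c a q (v n) t := by
  unfold delayMap
  split_ifs with h
  · have h1 : ∀ u, (∫⁻ α in Ioc (-r) 0, a α * ⨆ n, v n (u + α))
        = ⨆ n, ∫⁻ α in Ioc (-r) 0, a α * v n (u + α) := by
      intro u
      rw [← lintegral_iSup (fun n => by have := hv n; fun_prop)]
      · simp_rw [ENNReal.mul_iSup]
      · intro n m hnm α
        exact mul_le_mul_right (hmono hnm _) _
    simp_rw [h1, ENNReal.iSup_add]
    rw [lintegral_iSup, ENNReal.add_iSup]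
    · exact fun n => (measurable_lag r ha (hv n)).add hq
    · intro n m hnm u
      dsimp only
      gcongr
      exact hmono hnm _
  · simp

/-- The exponential is a supersolution. Lags are nonpositive, so the kernel costs at most a factor
`A`, while integrating in time gains `1 / l`; as `A / l ≤ 1 / 2`, this uses half of the bound. The
other half absorbs the data, since the exponential is at least `1` after time `s`. -/
lemma delayMap_exp_le {s r A C l : ℝ} {c : ℝ≥0∞} {a q : ℝ → ℝ≥0∞}
    (ham : Measurable a) (hA : 0 ≤ A) (hl : 0 < l) (hAl : 2 * A ≤ l) (hC : 0 ≤ C)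
    (ha : ∫⁻ α in Ioc (-r) 0, a α ≤ ENNReal.ofReal A)
    (hq : c + ∫⁻ u, q u ≤ ENNReal.ofReal (C / 2)) (t : ℝ) :
    delayMap s r c a q (fun τ => ENNReal.ofReal (C * Real.exp (l * (τ - s)))) t
      ≤ ENNReal.ofReal (C * Real.exp (l * (t - s))) := by
  unfold delayMap
  split_ifs with h
  swap
  · simp
  have h1 : ∀ u, ∫⁻ α in Ioc (-r) 0, a α * ENNReal.ofReal (C * Real.exp (l * (u + α - s)))
      ≤ ENNReal.ofReal (A * (C * Real.exp (l * (u - s)))) := by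
    intro u
    rw [ENNReal.ofReal_mul hA]
    grw [← ha]
    rw [← lintegral_mul_const _ ham]
    refine setLIntegral_mono (by fun_prop) fun α hα => ?_
    have := hα.2
    gcongr
    linarith
  have hcont : Continuous fun u => A * (C * Real.exp (l * (u - s))) := by fun_prop
  have h2 : ∫⁻ u in Ioc s t, ENNReal.ofReal (A * (C * Real.exp (l * (u - s))))
      ≤ ENNReal.ofReal (C / 2 * Real.exp (l * (t - s)) - 0) := by
    rw [← ofReal_integral_eq_lintegral_ofReal
      (hcont.intervalIntegrable s t).1
      (ae_of_all _ fun u => by positivity), ← intervalIntegral.integral_of_le h]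
    refine ENNReal.ofReal_le_ofReal ?_
    have hd : ∀ u ∈ uIcc s t, HasDerivAt (fun u => A * (C * (Real.exp (l * (u - s)) / l)))
        (A * (C * Real.exp (l * (u - s)))) u := by
      intro u _
      have : HasDerivAt (fun u => Real.exp (l * (u - s))) (Real.exp (l * (u - s)) * (l * 1)) u :=
        (((hasDerivAt_id u).sub_const s).const_mul l).exp
      convert! ((this.div_const l).const_mul C).const_mul A using 1
      field_simp
    rw [intervalIntegral.integral_eq_sub_of_hasDerivAt hd (hcont.intervalIntegrable _ _)]
    have h3 : 0 ≤ A * (C * (Real.exp (l * (s - s)) / l)) := by positivity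
    have h4 : A * (C * (Real.exp (l * (t - s)) / l)) = (2 * A) * (C / 2 * Real.exp (l * (t - s))) / l := by
      field_simp
    have h5 : (2 * A) * (C / 2 * Real.exp (l * (t - s))) / l ≤ C / 2 * Real.exp (l * (t - s)) := by
      rw [div_le_iff₀ hl, mul_comm _ l]
      gcongr
    linarith
  calc c + ∫⁻ u in Ioc s t,
        ((∫⁻ α in Ioc (-r) 0, a α * ENNReal.ofReal (C * Real.exp (l * (u + α - s)))) + q u)
      ≤ c + ∫⁻ u in Ioc s t, (ENNReal.ofReal (A * (C * Real.exp (l * (u - s)))) + q u) := by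
        gcongr with u
        exact h1 u
    _ = (c + ∫⁻ u in Ioc s t, q u)
          + ∫⁻ u in Ioc s t, ENNReal.ofReal (A * (C * Real.exp (l * (u - s)))) := by
        rw [lintegral_add_left (by fun_prop)]
        ring
    _ ≤ ENNReal.ofReal (C / 2) + ENNReal.ofReal (C / 2 * Real.exp (l * (t - s)) - 0) := by
        gcongr
        exact le_trans (by gcongr; exact Measure.restrict_le_self) hq
    _ ≤ ENNReal.ofReal (C * Real.exp (l * (t - s))) := by
        rw [← ENNReal.ofReal_add (by positivity) (by simp; positivity)]
        refine ENNReal.ofReal_le_ofReal ?_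
        have : 1 ≤ Real.exp (l * (t - s)) :=
          Real.one_le_exp (mul_nonneg hl.le (sub_nonneg.2 h))
        nlinarith

lemma exists_delayMap_fixedPoint (s r : ℝ) {c : ℝ≥0∞} {a q : ℝ → ℝ≥0∞}
    (ham : Measurable a) (hqm : Measurable q) (hc : c ≠ ∞)
    (ha : ∫⁻ α in Ioc (-r) 0, a α ≠ ∞) (hq : ∫⁻ u, q u ≠ ∞) :
    ∃ v : ℝ → ℝ≥0∞, Measurable v ∧ delayMap s r c a q v = v ∧
      ∃ C l : ℝ, 0 ≤ C ∧ 0 < l ∧ ∀ t, v t ≤ ENNReal.ofReal (C * Real.exp (l * (t - s))) := by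
  set A := (∫⁻ α in Ioc (-r) 0, a α).toReal with hA
  set C := 2 * (c + ∫⁻ u, q u).toReal with hC
  -- The `+ 1` keeps the rate positive when the kernel has zero mass.
  set l := 2 * A + 1 with hl
  have hA0 : 0 ≤ A := ENNReal.toReal_nonneg
  have hC0 : 0 ≤ C := mul_nonneg zero_le_two ENNReal.toReal_nonneg
  set v : ℕ → ℝ → ℝ≥0∞ := fun n => (delayMap s r c a q)^[n] 0 with hv
  have hsucc : ∀ n, v (n + 1) = delayMap s r c a q (v n) := fun n =>
    Function.iterate_succ_apply' _ _ _
  have hvmono : Monotone v :=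
    (delayMap_mono s r c a q).monotone_iterate_of_le_map (fun t => by simp)
  have hvmeas : ∀ n, Measurable (v n) := by
    intro n
    cases n with
    | zero => exact measurable_zero
    | succ n => rw [hsucc]; exact delayMap_measurable ..
  refine ⟨fun t => ⨆ n, v n t, .iSup hvmeas, ?_, C, l, hC0, by positivity, fun t => iSup_le ?_⟩
  · funext t
    rw [delayMap_iSup s r c ham hqm hvmeas hvmono]
    simp_rw [← hsucc]
    exact (Monotone.iSup_nat_add (f := fun n => v n t) (fun n m h => hvmono h t) 1)
  · intro n
    induction n generalizing t with
    | zero => simp [hv]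
    | succ n ih =>
      rw [hsucc]
      refine (delayMap_mono s r c a q (fun τ => ih τ) t).trans
        (delayMap_exp_le ham hA0 (by positivity) (by linarith) hC0 ?_ ?_ t)
      · rw [hA, ENNReal.ofReal_toReal ha]
      · rw [hC, mul_div_cancel_left₀ _ two_ne_zero, ENNReal.ofReal_toReal (by simp [hc, hq])]

/-- After extension by zero, the integrand is the tensor product of `a` and `H` pulled back by a
measure-preserving shear; the extension changes nothing on the rectangle, where `u + α` stays in `[s
- r, T]`. -/
lemma integrable_lag_prod {s r T : ℝ} {a H : ℝ → ℝ} (ha : IntegrableOn a (Ioc (-r) 0))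
    (hH : IntegrableOn H (Icc (s - r) T)) :
    Integrable (fun p : ℝ × ℝ => a p.2 * H (p.1 + p.2))
      ((volume.restrict (Ioc s T)).prod (volume.restrict (Ioc (-r) 0))) := by
  have h1 := (((integrable_indicator_iff measurableSet_Ioc).2 ha).mul_prod
    ((integrable_indicator_iff measurableSet_Icc).2 hH))
  have h2 := (measurePreserving_prod_add_swap (volume : Measure ℝ) (volume : Measure ℝ)).integrable_comp_of_integrable h1
  rw [Measure.prod_restrict]
  refine (h2.restrict (s := Ioc s T ×ˢ Ioc (-r) 0)).congr ?_
  filter_upwards [ae_restrict_mem (measurableSet_Ioc.prod measurableSet_Ioc)] with p hp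
  obtain ⟨⟨h3, h4⟩, h5, h6⟩ := hp
  have h7 : p.2 + p.1 ∈ Icc (s - r) T := ⟨by linarith, by linarith⟩
  have h8 : p.2 ∈ Ioc (-r) 0 := ⟨h5, h6⟩
  simp only [Function.comp_apply, indicator_of_mem h7, indicator_of_mem h8, add_comm p.1]

lemma ae_integrable_lag {s r T : ℝ} {a H : ℝ → ℝ} (hr : 0 ≤ r) (ha : IntegrableOn a (Ioc (-r) 0))
    (hH : IntegrableOn H (Icc (s - r) T)) :
    ∀ᵐ u ∂(volume.restrict (Ioc s T)),
      IntervalIntegrable (fun α => a α * H (u + α)) volume (-r) 0 := by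
  filter_upwards [(integrable_lag_prod ha hH).prod_right_ae] with u hu
  rw [intervalIntegrable_iff_integrableOn_Ioc_of_le (by linarith)]
  exact hu

lemma integrableOn_lag {s r T : ℝ} {a H : ℝ → ℝ} (hr : 0 ≤ r) (ha : IntegrableOn a (Ioc (-r) 0))
    (hH : IntegrableOn H (Icc (s - r) T)) :
    IntegrableOn (fun u => ∫ α in (-r)..0, a α * H (u + α)) (Ioc s T) := by
  simp_rw [intervalIntegral.integral_of_le (show -r ≤ 0 by linarith)]
  exact (integrable_lag_prod ha hH).integral_prod_left

/-- The product rule for `t ↦ exp (b (t - s))` and a primitive. -/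
lemma exp_mul_primitive {s t : ℝ} (b c : ℝ) {g : ℝ → ℝ} (hg : IntervalIntegrable g volume s t) :
    Real.exp (b * (t - s)) * (c + ∫ u in s..t, g u)
      = c + ∫ u in s..t, (b * (Real.exp (b * (u - s)) * (c + ∫ τ in s..u, g τ))
          + Real.exp (b * (u - s)) * g u) := by
  have h1 : AbsolutelyContinuousOnInterval (fun x => ∫ u in s..x, g u) s t :=
    hg.absolutelyContinuousOnInterval_intervalIntegral left_mem_uIcc
  have h2 : AbsolutelyContinuousOnInterval (fun x => c + ∫ u in s..x, g u) s t :=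
    ((contDiff_const (c := c)).contDiffOn.absolutelyContinuousOnInterval).add h1
  have h3 : AbsolutelyContinuousOnInterval (fun x => Real.exp (b * (x - s))) s t := by
    refine ContDiffOn.absolutelyContinuousOnInterval (ContDiff.contDiffOn ?_)
    fun_prop
  -- As `g` is only integrable, its primitive is differentiable only almost everywhere, hence the
  -- absolutely continuous form of integration by parts.
  have h4 := h3.integral_deriv_mul_eq_sub h2
  have h5 : ∫ u in s..t, (b * (Real.exp (b * (u - s)) * (c + ∫ τ in s..u, g τ))
          + Real.exp (b * (u - s)) * g u)
      = ∫ x in s..t, deriv (fun x => Real.exp (b * (x - s))) x * (c + ∫ u in s..x, g u)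
        + Real.exp (b * (x - s)) * deriv (fun x => c + ∫ u in s..x, g u) x := by
    refine intervalIntegral.integral_congr_ae ?_
    filter_upwards [hg.ae_hasDerivAt_integral] with x hx hxm
    have d1 := ((hx (uIoc_subset_uIcc hxm) s left_mem_uIcc).const_add c).deriv
    have d2 : HasDerivAt (fun x => Real.exp (b * (x - s))) (Real.exp (b * (x - s)) * (b * 1)) x :=
      (((hasDerivAt_id x).sub_const s).const_mul b).exp
    rw [d1, d2.deriv]
    ring
  rw [h5, h4]
  simp

/-- The delay equation without instantaneous term has a nonnegative solution. -/
lemma exists_nonneg_pureDelay_solution {s r T c : ℝ} {a f : ℝ → ℝ} (hr : 0 ≤ r)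
    (ham : Measurable a) (ha : IntegrableOn a (Ioc (-r) 0))
    (ha0 : ∀ᵐ α ∂(volume.restrict (Ioc (-r) 0)), 0 ≤ a α)
    (hfm : Measurable f) (hf : IntegrableOn f (Ioc s T))
    (hf0 : ∀ᵐ u ∂(volume.restrict (Ioc s T)), 0 ≤ f u) (hc : 0 ≤ c) :
    ∃ v : ℝ → ℝ, Measurable v ∧ (∀ t, 0 ≤ v t) ∧ (∀ t < s, v t = 0) ∧ (∃ C, ∀ t, v t ≤ C) ∧
      ∀ t ∈ Icc s T, v t
        = c + ∫ u in s..t, ((∫ α in (-r)..0, a α * v (u + α)) + f u) := by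
  set q : ℝ → ℝ≥0∞ := fun u => (Ioc s T).indicator (fun u => ENNReal.ofReal (f u)) u with hq
  have hqm : Measurable q := (ENNReal.measurable_ofReal.comp hfm).indicator measurableSet_Ioc
  have ham' : Measurable fun α => ENNReal.ofReal (a α) := by fun_prop
  obtain ⟨w, hwm, hw, C, l, hC, hl, hwC⟩ := exists_delayMap_fixedPoint s r (c := ENNReal.ofReal c)
    ham' hqm ENNReal.ofReal_ne_top ha.lintegral_lt_top.ne
    (by rw [hq, lintegral_indicator measurableSet_Ioc]; exact hf.lintegral_lt_top.ne)
  have hwfin : ∀ t, w t < ∞ := fun t => (hwC t).trans_lt ENNReal.ofReal_lt_top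
  -- The cut at `T` turns the exponential bound into a uniform one. It does not disturb the equation
  -- on `[s, T]`, which looks only backwards in time.
  refine ⟨fun t => if t ≤ T then (w t).toReal else 0,
    Measurable.ite measurableSet_Iic hwm.ennreal_toReal measurable_const,
    fun t => by dsimp only; split_ifs <;> simp, fun t ht => ?_,
    ⟨C * Real.exp (l * (T - s)), fun t => ?_⟩, fun t ht => ?_⟩
  · rw [← hw]
    simp [delayMap, ht.not_ge]
  · dsimp only
    split_ifs with h
    · refine (ENNReal.toReal_le_of_le_ofReal (by positivity) (hwC t)).trans ?_
      gcongr
    · positivity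
  · have hlagfin : ∀ u, ∫⁻ α in Ioc (-r) 0, ENNReal.ofReal (a α) * w (u + α) < ∞ := by
      intro u
      refine lt_of_le_of_lt (setLIntegral_mono (g := fun α => ENNReal.ofReal (a α)
        * ENNReal.ofReal (C * Real.exp (l * (u - s)))) (by fun_prop) fun α hα => ?_) ?_
      · have := hα.2
        gcongr
        refine (hwC _).trans ?_
        gcongr
        linarith
      · rw [lintegral_mul_const _ ham']
        exact ENNReal.mul_lt_top ha.lintegral_lt_top ENNReal.ofReal_lt_top
    have hqt : ∫⁻ u, q u < ∞ := by
      rw [hq, lintegral_indicator measurableSet_Ioc]; exact hf.lintegral_lt_top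
    simp only [ht.2, if_true]
    have hwt : ENNReal.ofReal c + ∫⁻ u in Ioc s t,
        ((∫⁻ α in Ioc (-r) 0, ENNReal.ofReal (a α) * w (u + α)) + q u) < ∞ := by
      have := hwfin t
      rwa [← hw, delayMap, if_pos ht.1] at this
    have hwe := congrFun hw t
    rw [delayMap, if_pos ht.1] at hwe
    have hlm := (measurable_lag r ham' hwm).add hqm
    rw [← hwe, ENNReal.toReal_add ENNReal.ofReal_ne_top (ENNReal.add_lt_top.1 hwt).2.ne,
      ENNReal.toReal_ofReal hc, intervalIntegral.integral_of_le ht.1, ← integral_toReal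
        (by exact hlm.aemeasurable)]
    swap
    · filter_upwards [ae_lt_top hqm hqt.ne |>.filter_mono (ae_mono Measure.restrict_le_self)] with u hu
      exact ENNReal.add_lt_top.2 ⟨hlagfin u, hu⟩
    congr 1
    refine integral_congr_ae ?_
    filter_upwards [ae_restrict_mem measurableSet_Ioc,
      ae_restrict_of_ae_restrict_of_subset (Ioc_subset_Ioc_right ht.2) hf0] with u hu hfu
    have huT : u ≤ T := hu.2.trans ht.2
    have hqu : q u = ENNReal.ofReal (f u) := indicator_of_mem (show u ∈ Ioc s T from ⟨hu.1, huT⟩) _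
    rw [ENNReal.toReal_add (hlagfin u).ne (by rw [hqu]; exact ENNReal.ofReal_ne_top), hqu,
      ENNReal.toReal_ofReal hfu, ← integral_toReal (by fun_prop)
        (ae_of_all _ fun α => ENNReal.mul_lt_top ENNReal.ofReal_lt_top (hwfin _)),
      intervalIntegral.integral_of_le (by linarith)]
    congr 1
    refine integral_congr_ae ?_
    filter_upwards [ha0, ae_restrict_mem measurableSet_Ioc] with α hα hαm
    rw [if_pos (by linarith [hαm.2]), ENNReal.toReal_mul, ENNReal.toReal_ofReal hα]

/-- A linear delay equation with nonnegative memory kernel and nonnegative data has a nonnegative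
solution. -/
theorem exists_nonneg_delay_solution {s r T c : ℝ} {a f : ℝ → ℝ} (b : ℝ) (hr : 0 ≤ r)
    (ham : Measurable a) (ha : IntegrableOn a (Ioc (-r) 0))
    (ha0 : ∀ᵐ α ∂(volume.restrict (Ioc (-r) 0)), 0 ≤ a α)
    (hfm : Measurable f) (hf : IntegrableOn f (Ioc s T))
    (hf0 : ∀ᵐ u ∂(volume.restrict (Ioc s T)), 0 ≤ f u) (hc : 0 ≤ c) :
    ∃ y : ℝ → ℝ, Measurable y ∧ (∀ t, 0 ≤ y t) ∧ (∀ t < s, y t = 0) ∧ (∃ C, ∀ t, y t ≤ C) ∧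
      ContinuousOn y (Icc s T) ∧
      ∀ t ∈ Icc s T, y t
        = c + ∫ u in s..t, (b * y u + (∫ α in (-r)..0, a α * y (u + α)) + f u) := by
  have hexp : ∀ k : ℝ, Continuous fun x : ℝ => Real.exp (b * (x - k)) := fun k => by fun_prop
  have hexp' : Continuous fun x : ℝ => Real.exp (b * x) := by fun_prop
  have hexp'' : Continuous fun x : ℝ => Real.exp (-(b * (x - s))) := by fun_prop
  have ha' : IntegrableOn (fun α => Real.exp (b * α) * a α) (Ioc (-r) 0) := by
    rw [← intervalIntegrable_iff_integrableOn_Ioc_of_le (by linarith)] at ha ⊢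
    exact ha.continuousOn_mul hexp'.continuousOn
  have hf' : IntegrableOn (fun u => Real.exp (-(b * (u - s))) * f u) (Ioc s T) := by
    rcases le_total s T with h | h
    · rw [← intervalIntegrable_iff_integrableOn_Ioc_of_le h] at hf ⊢
      exact hf.continuousOn_mul hexp''.continuousOn
    · simp [Ioc_eq_empty_of_le h]
  -- Substituting `y(t) = exp (b (t - s)) v(t)` removes the term `b y`, whose sign is not
  -- controlled, and multiplies kernel and forcing by positive factors.
  obtain ⟨v, hvm, hv0, hvs, ⟨C, hvC⟩, hv⟩ := exists_nonneg_pureDelay_solution hr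
    (a := fun α => Real.exp (b * α) * a α) (f := fun u => Real.exp (-(b * (u - s))) * f u)
    (by fun_prop) ha' (by filter_upwards [ha0] with α h using by positivity) (by fun_prop) hf'
    (by filter_upwards [hf0] with α h using by positivity) hc
  have hvI : IntegrableOn v (Icc (s - r) T) := by
    refine Measure.integrableOn_of_bounded (M := C) measure_Icc_lt_top.ne
      hvm.aestronglyMeasurable (ae_of_all _ fun t => ?_)
    rw [Real.norm_of_nonneg (hv0 t)]
    exact hvC t
  have hint : ∀ t ∈ Icc s T, IntervalIntegrable (fun u =>
      (∫ α in (-r)..0, Real.exp (b * α) * a α * v (u + α)) + Real.exp (-(b * (u - s))) * f u)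
      volume s t := by
    intro t ht
    rw [intervalIntegrable_iff_integrableOn_Ioc_of_le ht.1]
    exact ((integrableOn_lag hr ha' hvI).add hf').mono_set (Ioc_subset_Ioc_right ht.2)
  have hvc : ContinuousOn v (Icc s T) := by
    rcases le_total s T with h | h
    · have h1 := hint T (right_mem_Icc.2 h)
      have h2 := (h1.absolutelyContinuousOnInterval_intervalIntegral left_mem_uIcc).continuousOn
      rw [uIcc_of_le h] at h2
      exact (continuousOn_const.add h2).congr hv
    · exact (subsingleton_Icc_of_ge h).continuousOn _
  refine ⟨fun t => if t ≤ T then Real.exp (b * (t - s)) * v t else 0,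
    Measurable.ite measurableSet_Iic (by fun_prop) measurable_const,
    fun t => ?_, fun t ht => by simp [hvs t ht],
    ⟨Real.exp (|b| * |T - s|) * C, fun t => ?_⟩, ?_, fun t ht => ?_⟩
  · have := hv0 t
    dsimp only
    split_ifs <;> positivity
  · have hC : 0 ≤ C := (hv0 t).trans (hvC t)
    dsimp only
    split_ifs with h
    · rcases lt_or_ge t s with h' | h'
      · rw [hvs t h', mul_zero]
        positivity
      · refine mul_le_mul (Real.exp_le_exp.2 ?_) (hvC t) (hv0 t) (Real.exp_pos _).le
        have : |t - s| ≤ |T - s| := abs_le_abs_of_nonneg (by linarith) (by linarith)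
        calc b * (t - s) ≤ |b * (t - s)| := le_abs_self _
          _ ≤ _ := by rw [abs_mul]; gcongr
    · positivity
  · refine ((hexp s).continuousOn.mul hvc).congr fun t ht => ?_
    simp [ht.2]
  · simp only [ht.2, if_true]
    rw [hv t ht, exp_mul_primitive b c (hint t ht)]
    congr 1
    rw [intervalIntegral.integral_of_le ht.1, intervalIntegral.integral_of_le ht.1]
    refine setIntegral_congr_fun measurableSet_Ioc fun u hu => ?_
    have huT : u ≤ T := hu.2.trans ht.2
    have h1 : ∫ α in (-r)..0, a α
          * (if u + α ≤ T then Real.exp (b * (u + α - s)) * v (u + α) else 0)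
        = Real.exp (b * (u - s)) * ∫ α in (-r)..0, Real.exp (b * α) * a α * v (u + α) := by
      rw [← intervalIntegral.integral_const_mul, intervalIntegral.integral_of_le (by linarith),
        intervalIntegral.integral_of_le (by linarith)]
      refine setIntegral_congr_fun measurableSet_Ioc fun α hα => ?_
      rw [if_pos (by linarith [hα.2]), show b * (u + α - s) = b * (u - s) + b * α by ring,
        Real.exp_add]
      ring
    rw [if_pos huT, h1, ← hv u ⟨hu.1.le, huT⟩, mul_add, ← mul_assoc (Real.exp _) (Real.exp _),
      ← Real.exp_add, add_neg_cancel, Real.exp_zero, one_mul]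
    ring

/-! ### Comparison for the controlled delay equation -/

lemma integrable_L2 {r : ℝ} (g : L2 r) : IntegrableOn (fun ξ => g ξ) (Icc (-r) 0) :=
  (Lp.memLp g).integrable (by norm_num)

lemma measurable_L2 {r : ℝ} (g : L2 r) : Measurable (fun ξ => g ξ) :=
  (Lp.stronglyMeasurable g).measurable

lemma integrableOn_withHistory {s r T : ℝ} {past f : ℝ → ℝ} (hp : IntegrableOn past (Icc (-r) 0))
    (hf : IntegrableOn f (Icc s T)) : IntegrableOn (withHistory s past f) (Icc (s - r) T) := by
  have h1 : IntegrableOn (fun t => past (t - s)) (Ico (s - r) s) := by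
    have h := ((integrable_indicator_iff measurableSet_Icc).2 hp).comp_sub_right s
    refine (h.integrableOn (s := Ico (s - r) s)).congr_fun (fun t ht => ?_) measurableSet_Ico
    exact indicator_of_mem (show t - s ∈ Icc (-r) 0 from
      ⟨by linarith [ht.1], by linarith [ht.2]⟩) _
  have h2 : IntegrableOn (withHistory s past f) (Ico (s - r) s) :=
    h1.congr_fun (fun t ht => by simp [withHistory, ht.2]) measurableSet_Ico
  have h3 : IntegrableOn (withHistory s past f) (Icc s T) :=
    hf.congr_fun (fun t ht => by simp [withHistory, ht.1.not_gt]) measurableSet_Icc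
  refine (h2.union h3).mono_set fun t ht => ?_
  rcases lt_or_ge t s with h | h
  · exact Or.inl ⟨ht.1, h⟩
  · exact Or.inr ⟨h, ht.2⟩

variable {Ω : Type*} [mΩ : MeasurableSpace Ω]

lemma IsAdmissible.integrableOn_path {M : Model} {P : Measure Ω} {W : ℝ≥0 → Ω → ℝ}
    {z : ℝ → Ω → ℝ} (hz : IsAdmissible M P W z) {s : ℝ} (hs : 0 ≤ s) (ω : Ω) :
    IntegrableOn (fun t => z t ω) (Icc s M.T) := by
  have h1 : AEMeasurable (fun t => z t ω) (volume.restrict (Icc 0 M.T)) := by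
    rw [aemeasurable_restrict_iff_comap_subtype measurableSet_Icc]
    exact (hz.measurable.comp measurable_prodMk_right).aemeasurable
  refine IntegrableOn.mono_set ?_ (Icc_subset_Icc_left hs)
  refine ⟨h1.aestronglyMeasurable, HasFiniteIntegral.of_bounded (C := M.uMax) ?_⟩
  filter_upwards [ae_restrict_mem measurableSet_Icc] with t ht
  have := hz.mem t ht ω
  rw [Real.norm_of_nonneg (M.uMin_nonneg.trans this.1)]
  exact this.2

/-- The correction `d` is deterministic, so `y + d` remains adapted, and control and noise cancel in
the difference of the two equations. -/
lemma IsDelaySolution.exists_ge {M : Model} {P : Measure Ω} {W : ℝ≥0 → Ω → ℝ}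
    {z : ℝ → Ω → ℝ} (hz : IsAdmissible M P W z)
    (ha₁ : ∀ᵐ ξ ∂(volume.restrict (Icc (-M.r) 0)), 0 ≤ M.a₁ ξ) {s : ℝ} (hs : s ∈ Icc 0 M.T)
    {x x' : State M.r} (hx : StateLE x x') {δ : L2 M.r} {y : ℝ → Ω → ℝ}
    (hy : IsDelaySolution M P W s x δ z y) :
    ∃ y', IsDelaySolution M P W s x' δ z y' ∧ ∀ ω, y M.T ω ≤ y' M.T ω := by
  have hr := M.r_pos.le
  have hIoc : ∀ g : L2 M.r, IntegrableOn (fun ξ => g ξ) (Ioc (-M.r) 0) := fun g =>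
    (integrable_L2 g).mono_set Ioc_subset_Icc_self
  set h : ℝ → ℝ := fun ξ => x'.snd ξ - x.snd ξ with hh
  have hhm : Measurable h := (measurable_L2 _).sub (measurable_L2 _)
  have hhI : IntegrableOn h (Icc (-M.r) 0) := (integrable_L2 _).sub (integrable_L2 _)
  -- The positive solution `d` vanishes before `s`, so the difference of the two histories has to
  -- enter its equation as a forcing term, through `g`.
  set g : ℝ → ℝ := withHistory s h 0 with hg
  have hgm : Measurable g :=
    Measurable.ite measurableSet_Iio (by fun_prop) measurable_const
  have hgI : IntegrableOn g (Icc (s - M.r) M.T) := integrableOn_withHistory hhI integrableOn_zero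
  have hg0 : ∀ᵐ t, s - M.r ≤ t → 0 ≤ g t := by
    have h1 := (ae_restrict_iff' measurableSet_Icc).1 hx.2
    have h2 := (measurePreserving_sub_right (volume : Measure ℝ) s).quasiMeasurePreserving.ae h1
    filter_upwards [h2] with t ht hst
    simp only [hg, withHistory]
    split_ifs with hts
    · exact sub_nonneg.2 (ht ⟨by linarith, by linarith⟩)
    · exact le_rfl
  obtain ⟨d, hdm, hd0, hds, ⟨C, hdC⟩, hdc, hd⟩ := exists_nonneg_delay_solution (T := M.T) M.a₀
    (c := x'.fst - x.fst) (f := fun u => ∫ α in (-M.r)..0, M.a₁ α * g (u + α)) hr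
    (measurable_L2 M.a₁) (hIoc M.a₁) (ae_restrict_of_ae_restrict_of_subset Ioc_subset_Icc_self ha₁)
    (by
      simp_rw [intervalIntegral.integral_of_le (show -M.r ≤ 0 by linarith)]
      have h1 := measurable_L2 M.a₁
      have h2 : Measurable fun p : ℝ × ℝ => M.a₁ p.2 * g (p.1 + p.2) := by fun_prop
      exact (h2.stronglyMeasurable.integral_prod_right').measurable)
    (integrableOn_lag hr (hIoc M.a₁) hgI)
    (by
      filter_upwards [ae_restrict_mem measurableSet_Ioc] with u hu
      rw [intervalIntegral.integral_of_le (by linarith)]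
      refine integral_nonneg_of_ae ?_
      filter_upwards [ae_restrict_of_ae_restrict_of_subset Ioc_subset_Icc_self ha₁,
        ae_restrict_mem measurableSet_Ioc, ae_restrict_of_ae
        ((measurePreserving_add_left (volume : Measure ℝ) u).quasiMeasurePreserving.ae hg0)]
        with α h1 h2 h3
      exact mul_nonneg h1 (h3 (by linarith [hu.1, h2.1])))
    (sub_nonneg.2 hx.1)
  have hdI : ∀ k, IntegrableOn d (Icc k M.T) := fun k => by
    refine Measure.integrableOn_of_bounded (M := C) measure_Icc_lt_top.ne
      hdm.aestronglyMeasurable (ae_of_all _ fun t => ?_)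
    rw [Real.norm_of_nonneg (hd0 t)]
    exact hdC t
  refine ⟨fun t ω => y t ω + d t, ⟨fun t ht => (hy.adapted t ht).add_const _, ?_, ?_⟩,
    fun ω => le_add_of_nonneg_right (hd0 _)⟩
  · filter_upwards [hy.continuous] with ω hω using hω.add hdc
  · filter_upwards [hy.continuous, hy.equation] with ω hc he t ht
    have hzI := hz.integrableOn_path hs.1 ω
    have hyI : IntegrableOn (fun τ => y τ ω) (Icc s M.T) := hc.integrableOn_Icc
    have hH := integrableOn_withHistory (integrable_L2 x.snd) hyI
    have hZ := integrableOn_withHistory (integrable_L2 δ) hzI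
    have hsub : Ioc s t ⊆ Icc s M.T := fun u hu => ⟨hu.1.le, hu.2.trans ht.2⟩
    have hsub' : Ioc s t ⊆ Ioc s M.T := Ioc_subset_Ioc_right ht.2
    rw [he t ht, hd t ht]
    have key : ∫ u in s..t, (M.a₀ * (y u ω + d u)
          + (∫ ξ in (-M.r)..0, M.a₁ ξ * withHistory s x'.snd (fun τ => y τ ω + d τ) (u + ξ))
          + M.b₀ * z u ω
          + ∫ ξ in (-M.r)..0, M.b₁ ξ * withHistory s δ (fun τ => z τ ω) (u + ξ))
        = (∫ u in s..t, (M.a₀ * y u ω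
          + (∫ ξ in (-M.r)..0, M.a₁ ξ * withHistory s x.snd (fun τ => y τ ω) (u + ξ))
          + M.b₀ * z u ω
          + ∫ ξ in (-M.r)..0, M.b₁ ξ * withHistory s δ (fun τ => z τ ω) (u + ξ)))
          + ∫ u in s..t, (M.a₀ * d u + (∫ α in (-M.r)..0, M.a₁ α * d (u + α))
            + ∫ α in (-M.r)..0, M.a₁ α * g (u + α)) := by
      rw [← intervalIntegral.integral_add]
      · rw [intervalIntegral.integral_of_le ht.1, intervalIntegral.integral_of_le ht.1]
        refine integral_congr_ae ?_
        filter_upwards [ae_restrict_of_ae_restrict_of_subset hsub'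
            (ae_integrable_lag hr (hIoc M.a₁) hH),
          ae_restrict_of_ae_restrict_of_subset hsub'
            (ae_integrable_lag hr (hIoc M.a₁) hgI),
          ae_restrict_of_ae_restrict_of_subset hsub'
            (ae_integrable_lag hr (hIoc M.a₁) (hdI (s - M.r)))] with u h1 h2 h3
        have h4 : ∫ ξ in (-M.r)..0, M.a₁ ξ * withHistory s x'.snd (fun τ => y τ ω + d τ) (u + ξ)
            = (∫ ξ in (-M.r)..0, M.a₁ ξ * withHistory s x.snd (fun τ => y τ ω) (u + ξ))
              + (∫ α in (-M.r)..0, M.a₁ α * d (u + α))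
              + ∫ α in (-M.r)..0, M.a₁ α * g (u + α) := by
          -- The integrands agree pointwise: before `s` the new history is the old one plus `h` and
          -- `d` vanishes; from `s` on, `g` vanishes.
          rw [← intervalIntegral.integral_add h1 h3,
            ← intervalIntegral.integral_add (h1.add h3) h2]
          congr 1
          funext α
          simp only [hg, hh, withHistory]
          split_ifs with hα
          · rw [hds _ hα]
            ring
          · simp only [Pi.zero_apply]
            ring
        rw [h4]
        ring
      · rw [intervalIntegrable_iff_integrableOn_Ioc_of_le ht.1]
        exact ((((hyI.mono_set hsub).const_mul _).add
          ((integrableOn_lag hr (hIoc M.a₁) hH).mono_set hsub')).add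
          ((hzI.mono_set hsub).const_mul _)).add
          ((integrableOn_lag hr (hIoc M.b₁) hZ).mono_set hsub')
      · rw [intervalIntegrable_iff_integrableOn_Ioc_of_le ht.1]
        exact ((((hdI s).mono_set hsub).const_mul _).add
          ((integrableOn_lag hr (hIoc M.a₁) (hdI (s - M.r))).mono_set hsub')).add
          ((integrableOn_lag hr (hIoc M.a₁) hgI).mono_set hsub')
    rw [key]
    ring

/-- The positive part of the payoff grows and the negative part shrinks, and subtraction in `EReal`
respects this even at infinite values, so no integrability is involved. -/
lemma payoff_mono {M : Model} (hφ₀ : Monotone M.φ₀) (P : Measure Ω) (s : ℝ) (z : ℝ → Ω → ℝ)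
    {η η' : Ω → ℝ} (h : ∀ ω, η ω ≤ η' ω) : payoff M P s z η ≤ payoff M P s z η' := by
  unfold payoff expectation
  refine EReal.sub_le_sub ?_ ?_
  · refine EReal.coe_ennreal_le_coe_ennreal_iff.2 (lintegral_mono fun ω => ?_)
    exact ENNReal.ofReal_le_ofReal (sub_le_sub_right (hφ₀ (h ω)) _)
  · refine EReal.coe_ennreal_le_coe_ennreal_iff.2 (lintegral_mono fun ω => ?_)
    exact ENNReal.ofReal_le_ofReal (neg_le_neg (sub_le_sub_right (hφ₀ (h ω)) _))

theorem delayValue_mono {M : Model} (P : Measure Ω) (W : ℝ≥0 → Ω → ℝ)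
    (ha₁ : ∀ᵐ ξ ∂(volume.restrict (Icc (-M.r) 0)), 0 ≤ M.a₁ ξ) (hφ₀ : Monotone M.φ₀) {s : ℝ}
    (hs : s ∈ Icc 0 M.T) {x x' : State M.r} (hx : StateLE x x') (δ : L2 M.r) :
    delayValue M P W δ s x ≤ delayValue M P W δ s x' := by
  refine iSup₂_le fun z hz => iSup₂_le fun y hy => ?_
  obtain ⟨y', hy', hle⟩ := hy.exists_ge hz ha₁ hs hx
  exact (payoff_mono hφ₀ P s z hle).trans
    (le_iSup₂_of_le z hz (le_iSup₂_of_le y' hy' le_rfl))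

/-! ### The transported memory -/

lemma setIntegral_Iic_comp_add (g : ℝ → ℝ) (ξ c : ℝ) :
    ∫ ζ in Iic ξ, g (ζ + c) = ∫ ζ in Iic (ξ + c), g ζ := by
  have := (measurePreserving_add_right (volume : Measure ℝ) c).setIntegral_preimage_emb
    (measurableEmbedding_addRight c) g (Iic (ξ + c))
  rw [← this]
  congr 2
  ext ζ
  simp

lemma intervalIntegral_reflect {g : ℝ → ℝ} (hg : Integrable g) (s t ξ : ℝ) :
    ∫ u in s..t, g (ξ - u + s) = (∫ ζ in Iic ξ, g ζ) - ∫ ζ in Iic (ξ - t + s), g ζ := by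
  have h1 : ∀ u, g (ξ - u + s) = g (ξ + s - u) := fun u => by congr 1; ring
  simp_rw [h1]
  rw [intervalIntegral.integral_comp_sub_left, intervalIntegral.integral_Iic_sub_Iic
    hg.integrableOn hg.integrableOn]
  congr 1 <;> ring

lemma integrable_mul_comp_add {w g : ℝ → ℝ} (hw : Integrable w) (hg : Integrable g) :
    Integrable (fun p : ℝ × ℝ => w p.2 * g (p.1 + p.2)) (volume.prod volume) := by
  have h := (measurePreserving_prod_add_swap (volume : Measure ℝ)
    (volume : Measure ℝ)).integrable_comp_of_integrable (hw.mul_prod hg)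
  exact h.congr (ae_of_all _ fun p => by simp [add_comm])

lemma integrable_mul_comp_sub {w g : ℝ → ℝ} (hw : Integrable w) (hg : Integrable g) :
    Integrable (fun p : ℝ × ℝ => w p.2 * g (p.1 - p.2)) (volume.prod volume) :=
  hw.convolution_integrand (ContinuousLinearMap.mul ℝ ℝ) hg

/-- The memory component at time `u` of the trajectory that starts at time `s` with memory `k`,
when the present value `y τ` feeds `y τ • a` into the memory at every time `τ`, and the memory is
shifted to the right at unit speed. -/
noncomputable def transport (s : ℝ) (a k y : ℝ → ℝ) (u ξ : ℝ) : ℝ :=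
  k (ξ - u + s) + ∫ τ in Iio u, y τ * a (ξ - u + τ)

section

variable {s : ℝ} {a k y : ℝ → ℝ}

lemma measurable_transport (ham : Measurable a) (hkm : Measurable k) (hym : Measurable y) :
    Measurable fun p : ℝ × ℝ => transport s a k y p.1 p.2 := by
  have h1 : Measurable fun q : (ℝ × ℝ) × ℝ =>
      {q : (ℝ × ℝ) × ℝ | q.2 < q.1.1}.indicator (fun q => y q.2 * a (q.1.2 - q.1.1 + q.2)) q :=
    Measurable.indicator (by fun_prop) (measurableSet_lt (by fun_prop) (by fun_prop))
  have h2 := (h1.stronglyMeasurable.integral_prod_right' (ν := volume)).measurable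
  have h3 : Measurable fun p : ℝ × ℝ => ∫ τ in Iio p.1, y τ * a (p.2 - p.1 + τ) := by
    convert! h2 using 2 with p
    rw [← integral_indicator measurableSet_Iio]
    rfl
  exact Measurable.add (by fun_prop) h3

/-- By translation invariance the bound is uniform in both `u` and `ξ`. -/
lemma abs_memory_le {C : ℝ} (ha : Integrable a) (hC : 0 ≤ C) (hy : ∀ τ, |y τ| ≤ C) (u ξ : ℝ) :
    |∫ τ in Iio u, y τ * a (ξ - u + τ)| ≤ C * ∫ τ, |a τ| := by
  have h1 : Integrable fun τ => C * |a (ξ - u + τ)| := (ha.comp_add_left (ξ - u)).abs.const_mul C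
  calc |∫ τ in Iio u, y τ * a (ξ - u + τ)| ≤ ∫ τ in Iio u, C * |a (ξ - u + τ)| := by
        rw [← Real.norm_eq_abs]
        refine norm_integral_le_of_norm_le h1.integrableOn (ae_of_all _ fun τ => ?_)
        rw [Real.norm_eq_abs, abs_mul]
        exact mul_le_mul_of_nonneg_right (hy τ) (abs_nonneg _)
    _ ≤ ∫ τ, C * |a (ξ - u + τ)| :=
        setIntegral_le_integral h1 (ae_of_all _ fun τ => by positivity)
    _ = C * ∫ τ, |a τ| := by
        rw [integral_const_mul, integral_add_left_eq_self (μ := volume) (fun τ => |a τ|) (ξ - u)]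

lemma transport_initial (hys : ∀ τ < s, y τ = 0) (ξ : ℝ) : transport s a k y s ξ = k ξ := by
  have : ∫ τ in Iio s, y τ * a (ξ - s + τ) = 0 :=
    setIntegral_eq_zero_of_forall_eq_zero fun τ hτ => by rw [hys τ hτ, zero_mul]
  rw [transport, this, sub_add_cancel, add_zero]

lemma integral_memory (ha : Integrable a) (hy : Integrable y) (t ξ : ℝ) :
    ∫ ζ in Iic ξ, (∫ τ in Iio t, y τ * a (ζ - t + τ))
      = ∫ τ in Iio t, y τ * ∫ ζ in Iic (ξ - t + τ), a ζ := by
  have h1 : Integrable (fun p : ℝ × ℝ => y p.2 * a (p.1 - t + p.2)) (volume.prod volume) := by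
    refine (integrable_mul_comp_add hy (ha.comp_sub_right t)).congr (ae_of_all _ fun p => ?_)
    simp only [sub_add_eq_add_sub]
  rw [integral_integral_swap (by rw [Measure.prod_restrict]; exact h1.restrict)]
  refine setIntegral_congr_fun measurableSet_Iio fun τ _ => ?_
  rw [integral_const_mul, show ξ - t + τ = ξ + (τ - t) by ring, ← setIntegral_Iic_comp_add]
  congr 2
  funext ζ
  congr 1
  ring

lemma integrableOn_memory (ha : Integrable a) (hy : Integrable y) (t ξ : ℝ) :
    IntegrableOn (fun ζ => ∫ τ in Iio t, y τ * a (ζ - t + τ)) (Iic ξ) := by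
  have h1 : Integrable (fun p : ℝ × ℝ => y p.2 * a (p.1 - t + p.2)) (volume.prod volume) := by
    refine (integrable_mul_comp_add hy (ha.comp_sub_right t)).congr (ae_of_all _ fun p => ?_)
    simp only [sub_add_eq_add_sub]
  have h2 : Integrable (fun p : ℝ × ℝ => y p.2 * a (p.1 - t + p.2))
      ((volume.restrict (Iic ξ)).prod (volume.restrict (Iio t))) := by
    rw [Measure.prod_restrict]; exact h1.restrict
  exact h2.integral_prod_left

lemma integrable_causal (ha : Integrable a) (hy : Integrable y) (s t ξ : ℝ) :
    Integrable (fun p : ℝ × ℝ => (Iio p.1).indicator (fun τ => y τ * a (ξ - p.1 + τ)) p.2)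
      ((volume.restrict (Ioc s t)).prod (volume.restrict (Iio t))) := by
  have h1 := integrable_mul_comp_sub hy (ha.comp_sub_left ξ)
  rw [Measure.prod_restrict]
  refine ((h1.indicator (s := {p : ℝ × ℝ | p.2 < p.1})
    (measurableSet_lt measurable_snd measurable_fst)).restrict).congr (ae_of_all _ fun p => ?_)
  simp only [indicator, mem_ofPred_eq, mem_Iio]
  split_ifs
  · congr 2
    ring
  · rfl

/-- Moves the moving endpoint into an indicator over a fixed domain, the form in which Fubini
applies. -/
lemma memory_eq_causal {s t u : ℝ} (ξ : ℝ) (hu : u ∈ Ioc s t) :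
    ∫ τ in Iio u, y τ * a (ξ - u + τ)
      = ∫ τ in Iio t, (Iio u).indicator (fun τ => y τ * a (ξ - u + τ)) τ := by
  rw [setIntegral_indicator measurableSet_Iio, Iio_inter_Iio, min_eq_right hu.2]

lemma intervalIntegrable_memory {s t : ℝ} (hst : s ≤ t) (ha : Integrable a) (hy : Integrable y)
    (ξ : ℝ) :
    IntervalIntegrable (fun u => ∫ τ in Iio u, y τ * a (ξ - u + τ)) volume s t := by
  rw [intervalIntegrable_iff_integrableOn_Ioc_of_le hst]
  exact ((integrable_causal ha hy s t ξ).integral_prod_left).congr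
    ((ae_restrict_mem measurableSet_Ioc).mono fun u hu => (memory_eq_causal ξ hu).symm)

/-- Fubini on the region `τ < u`: for fixed `τ ≥ s` the variable `u` runs over `(τ, t]`, and
reflection turns the inner integral into a difference of primitives of `a`. -/
lemma integral_memory_time {s t : ℝ} (hst : s ≤ t) (ha : Integrable a) (hy : Integrable y)
    (hys : ∀ τ < s, y τ = 0) (ξ : ℝ) :
    ∫ u in s..t, (∫ τ in Iio u, y τ * a (ξ - u + τ))
      = ∫ τ in Iio t, y τ * ((∫ ζ in Iic ξ, a ζ) - ∫ ζ in Iic (ξ - t + τ), a ζ) := by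
  rw [intervalIntegral.integral_of_le hst, setIntegral_congr_fun measurableSet_Ioc
    fun u hu => memory_eq_causal ξ hu, integral_integral_swap (integrable_causal ha hy s t ξ)]
  refine setIntegral_congr_fun measurableSet_Iio fun τ hτ => ?_
  rcases lt_or_ge τ s with h | h
  · rw [hys τ h, zero_mul]
    refine integral_eq_zero_of_ae (ae_of_all _ fun u => ?_)
    simp only [indicator, hys τ h, zero_mul, ite_self, Pi.zero_apply]
  · have h1 : ∀ u, (Iio u).indicator (fun τ => y τ * a (ξ - u + τ)) τ
        = (Ioi τ).indicator (fun u => y τ * a (ξ - u + τ)) u := fun u => by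
      simp [indicator]
    simp_rw [h1]
    rw [setIntegral_indicator measurableSet_Ioi, integral_const_mul,
      show Ioc s t ∩ Ioi τ = Ioc τ t by ext; simp; grind,
      ← intervalIntegral.integral_of_le (le_of_lt hτ), intervalIntegral_reflect ha]

/-- The time integral of the transported memory is a primitive in the memory variable. -/
lemma integral_transport {t : ℝ} (hst : s ≤ t) (ha : Integrable a) (hk : Integrable k)
    (hy : Integrable y) (hys : ∀ τ < s, y τ = 0) (ξ : ℝ) :
    ∫ u in s..t, transport s a k y u ξ
      = ∫ ζ in Iic ξ, ((∫ τ in Iio t, y τ) * a ζ + k ζ - transport s a k y t ζ) := by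
  have hk1 : IntervalIntegrable (fun u => k (ξ - u + s)) volume s t := by
    refine (Integrable.intervalIntegrable ?_)
    exact (hk.comp_sub_left (ξ + s)).congr (ae_of_all _ fun u => by dsimp only; congr 1; ring)
  have hk2 : Integrable fun ζ => k (ζ - t + s) :=
    (hk.comp_add_right (s - t)).congr (ae_of_all _ fun u => by dsimp only; congr 1; ring)
  have hm := integrableOn_memory ha hy t ξ
  unfold transport
  -- With `K` and `A` the primitives of `k` and `a` from `-∞`, both sides reduce to `K(ξ) - K(ξ - t
  -- + s) + ∫ y(τ) (A(ξ) - A(ξ - t + τ)) dτ` over `τ < t`.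
  rw [intervalIntegral.integral_add hk1 (intervalIntegrable_memory hst ha hy ξ),
    intervalIntegral_reflect hk, integral_memory_time hst ha hy hys, integral_sub
      (f := fun ζ => (∫ τ in Iio t, y τ) * a ζ + k ζ)
      (g := fun ζ => k (ζ - t + s) + ∫ τ in Iio t, y τ * a (ζ - t + τ))
      ((ha.const_mul _).add hk).integrableOn (hk2.integrableOn.add hm),
    integral_add (ha.const_mul _).integrableOn hk.integrableOn, integral_const_mul,
    integral_add hk2.integrableOn hm, integral_memory ha hy]
  have h1 : ∫ ζ in Iic ξ, k (ζ - t + s) = ∫ ζ in Iic (ξ - t + s), k ζ := by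
    rw [show ξ - t + s = ξ + (s - t) by ring, ← setIntegral_Iic_comp_add]
    congr 2
    funext ζ
    congr 1
    ring
  have h2 : IntegrableOn (fun τ => y τ * ∫ ζ in Iic (ξ - t + τ), a ζ) (Iio t) := by
    have hc : Continuous fun x => ∫ ζ in Iic x, a ζ := by
      have : (fun x => ∫ ζ in Iic x, a ζ) = fun x => (∫ ζ in Iic 0, a ζ) + ∫ ζ in 0..x, a ζ := by
        funext x
        rw [← intervalIntegral.integral_Iic_sub_Iic ha.integrableOn ha.integrableOn]
        ring
      rw [this]
      exact continuous_const.add (intervalIntegral.continuous_primitive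
        (fun _ _ => ha.intervalIntegrable) 0)
    have hb : ∀ x, ‖∫ ζ in Iic x, a ζ‖ ≤ ∫ ζ, ‖a ζ‖ := fun x =>
      (norm_integral_le_integral_norm _).trans
        (setIntegral_le_integral ha.norm (ae_of_all _ fun _ => norm_nonneg _))
    refine (hy.mul_bdd (c := ∫ ζ, ‖a ζ‖) ?_ (ae_of_all _ fun τ => hb _)).integrableOn
    exact (hc.comp (by fun_prop : Continuous fun τ => ξ - t + τ)).aestronglyMeasurable
  simp_rw [mul_sub]
  rw [integral_sub (hy.integrableOn.mul_const _) h2, integral_mul_const, h1]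
  ring

end

/-! ### Comparison for the abstract equation -/

/-- By the Lindelöf property every open set is a countable union of balls, whose preimages are
measurable by assumption. In `L²` these distances are integrals of jointly measurable functions, so
measurability follows from Tonelli. -/
lemma stronglyMeasurable_of_dist {α E : Type*} [MeasurableSpace α] [PseudoMetricSpace E]
    [SecondCountableTopology E] {f : α → E} (hf : ∀ c, Measurable fun x => dist (f x) c) :
    StronglyMeasurable f := by
  borelize E
  refine Measurable.stronglyMeasurable (measurable_of_isOpen fun O hO => ?_)
  have h1 : ∀ c : O, ∃ ε > 0, Metric.ball (c : E) ε ⊆ O := fun c => Metric.isOpen_iff.1 hO c c.2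
  choose ε hε hsub using h1
  obtain ⟨S, hS, hSO⟩ := TopologicalSpace.isOpen_iUnion_countable
    (fun c : O => Metric.ball (c : E) (ε c)) fun c => Metric.isOpen_ball
  have h2 : O = ⋃ c ∈ S, Metric.ball (c : E) (ε c) := by
    rw [hSO]
    exact Subset.antisymm (fun c hc => mem_iUnion.2 ⟨⟨c, hc⟩, Metric.mem_ball_self (hε _)⟩)
      (iUnion_subset hsub)
  rw [h2, preimage_iUnion₂]
  exact MeasurableSet.biUnion hS fun c _ => hf c measurableSet_Iio

instance secondCountableTopology_L2 (r : ℝ) : SecondCountableTopology (L2 r) := by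
  have : Fact ((2 : ℝ≥0∞) ≠ ∞) := ⟨by norm_num⟩
  infer_instance

lemma stronglyMeasurable_toLp {r : ℝ} {F : ℝ → ℝ → ℝ} (hF : Measurable fun p : ℝ × ℝ => F p.1 p.2)
    (hmem : ∀ u, MemLp (F u) 2 (volume.restrict (Icc (-r) 0))) :
    StronglyMeasurable fun u => ((hmem u).toLp (F u) : L2 r) := by
  refine stronglyMeasurable_of_dist fun c => ?_
  have h1 : ∀ u, dist ((hmem u).toLp (F u)) c = ((∫⁻ ξ in Icc (-r) 0,
      ‖F u ξ - c ξ‖ₑ ^ (2 : ℝ≥0∞).toReal) ^ (1 / (2 : ℝ≥0∞).toReal)).toReal := by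
    intro u
    rw [Lp.dist_def, ← eLpNorm_eq_lintegral_rpow_enorm_toReal (by norm_num) (by norm_num)]
    congr 1
    refine eLpNorm_congr_ae ?_
    filter_upwards [(hmem u).coeFn_toLp] with ξ hξ
    rw [Pi.sub_apply, hξ]
  simp_rw [h1]
  refine (Measurable.pow_const ?_ _).ennreal_toReal
  have hc := measurable_L2 c
  exact Measurable.lintegral_prod_right'
    (f := fun p : ℝ × ℝ => ‖F p.1 p.2 - c p.2‖ₑ ^ (2 : ℝ≥0∞).toReal) (by fun_prop)

lemma norm_state_le {r : ℝ} (x : State r) : ‖x‖ ≤ ‖x.fst‖ + ‖x.snd‖ := by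
  have h := WithLp.prod_norm_sq_eq_of_L2 x
  nlinarith [norm_nonneg x, norm_nonneg x.fst, norm_nonneg x.snd]

/-- Translation preserves the norm of the initial memory, and the fed-in part is bounded uniformly.
The norm bound is independent of `u`, hence the trajectory is bounded. -/
lemma memLp_transport {r s C : ℝ} {a k y : ℝ → ℝ} (ham : Measurable a)
    (hym : Measurable y) (ha : Integrable a) (hk : MemLp k 2) (hC : 0 ≤ C)
    (hy : ∀ τ, |y τ| ≤ C) (u : ℝ) :
    ∃ h : MemLp (transport s a k y u) 2 (volume.restrict (Icc (-r) 0)),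
      ‖h.toLp (transport s a k y u)‖ ≤ (eLpNorm k 2 volume).toReal
        + (measureUnivNNReal (volume.restrict (Icc (-r) 0)) : ℝ) ^ (2 : ℝ≥0∞).toReal⁻¹
          * (C * ∫ τ, |a τ|) := by
  set μ := (volume : Measure ℝ).restrict (Icc (-r) 0)
  have hmp : MeasurePreserving (fun ξ : ℝ => ξ - u + s) volume volume := by
    have := measurePreserving_add_right (volume : Measure ℝ) (s - u)
    convert! this using 1
    funext ξ
    ring
  have h1 : MemLp (fun ξ => k (ξ - u + s)) 2 μ := (hk.comp_measurePreserving hmp).restrict _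
  have hmm : Measurable fun ξ => ∫ τ in Iio u, y τ * a (ξ - u + τ) := by
    have := (measurable_transport (s := s) ham (measurable_const (a := (0 : ℝ))) hym).comp
      (measurable_prodMk_left (x := u))
    convert! this using 2 with ξ
    simp [transport]
  have hbd := abs_memory_le ha hC hy u
  have h2 : MemLp (fun ξ => ∫ τ in Iio u, y τ * a (ξ - u + τ)) 2 μ :=
    MemLp.of_bound hmm.aestronglyMeasurable _ (ae_of_all _ hbd)
  refine ⟨h1.add h2, ?_⟩
  have h3 : (h1.add h2).toLp (transport s a k y u) = h1.toLp _ + h2.toLp _ :=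
    MemLp.toLp_add h1 h2
  rw [h3]
  refine (norm_add_le _ _).trans (add_le_add ?_ ?_)
  · rw [Lp.norm_toLp]
    refine ENNReal.toReal_mono hk.eLpNorm_lt_top.ne ?_
    rw [← eLpNorm_comp_measurePreserving hk.aestronglyMeasurable hmp]
    exact eLpNorm_mono_measure _ Measure.restrict_le_self
  · refine Lp.norm_le_of_ae_bound
      (mul_nonneg hC (integral_nonneg fun _ => abs_nonneg _)) ?_
    filter_upwards [h2.coeFn_toLp] with ξ hξ
    rw [hξ]
    exact hbd ξ

lemma integral_transport_mul {s t C : ℝ} {a k y w : ℝ → ℝ} (hst : s ≤ t)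
    (ham : Measurable a)
    (hym : Measurable y) (ha : Integrable a) (hk : Integrable k) (hC : 0 ≤ C)
    (hy : ∀ τ, |y τ| ≤ C) {S : Set ℝ} (hw : IntegrableOn w S) (hS : MeasurableSet S) :
    ∫ u in s..t, (∫ ξ in S, w ξ * transport s a k y u ξ)
      = ∫ ξ in S, w ξ * ∫ u in s..t, transport s a k y u ξ := by
  simp_rw [intervalIntegral.integral_of_le hst, ← integral_const_mul]
  refine integral_integral_swap ?_
  have hmm : Measurable fun p : ℝ × ℝ => ∫ τ in Iio p.1, y τ * a (p.2 - p.1 + τ) := by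
    have := measurable_transport (s := s) ham (measurable_const (a := (0 : ℝ))) hym
    convert! this using 2 with p
    simp [transport]
  have h1 : Integrable (fun p : ℝ × ℝ => w p.2 * k (p.2 - p.1 + s))
      ((volume.restrict (Ioc s t)).prod (volume.restrict S)) := by
    have h := integrable_mul_comp_sub ((integrable_indicator_iff hS).2 hw) (hk.comp_sub_left s)
    rw [Measure.prod_restrict]
    refine (h.restrict (s := Ioc s t ×ˢ S)).congr ?_
    filter_upwards [ae_restrict_mem (measurableSet_Ioc.prod hS)] with p hp
    rw [indicator_of_mem hp.2]
    congr 2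
    ring
  have h2 : Integrable (fun p : ℝ × ℝ => w p.2 * ∫ τ in Iio p.1, y τ * a (p.2 - p.1 + τ))
      ((volume.restrict (Ioc s t)).prod (volume.restrict S)) := by
    have h := hw.comp_snd (volume.restrict (Ioc s t))
    exact h.mul_bdd hmm.aestronglyMeasurable
      (ae_of_all _ fun p => abs_memory_le ha hC hy p.1 p.2)
  refine (h1.add h2).congr (ae_of_all _ fun p => ?_)
  simp only [Pi.add_apply, Function.uncurry, transport, mul_add]

/-- The homogeneous abstract equation has a bounded measurable deterministic weak solution whose
first component stays nonnegative if the initial datum is. -/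
theorem exists_homogeneous_weakSolution {M : Model}
    (ha₁ : ∀ᵐ ξ ∂(volume.restrict (Icc (-M.r) 0)), 0 ≤ M.a₁ ξ) (s : ℝ) {h : State M.r}
    (h0 : 0 ≤ h.fst) (h1 : ∀ᵐ ξ ∂(volume.restrict (Icc (-M.r) 0)), 0 ≤ h.snd ξ) (hs : s ≤ M.T) :
    ∃ D : ℝ → State M.r, StronglyMeasurable D ∧ (∃ C, ∀ t, ‖D t‖ ≤ C) ∧ D s = h ∧
      (∀ t, 0 ≤ (D t).fst) ∧
      ∀ v w : State M.r, (v, w) ∈ (generatorGraph M).adjoint → ∀ t ∈ Icc s M.T,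
        inner ℝ (D t) v = inner ℝ h v + ∫ u in s..t, inner ℝ (D u) w := by
  have hr := M.r_pos.le
  -- Extension by zero encodes the boundary condition `x₁(-r) = 0`: nothing flows in from the left
  -- of `-r`.
  set a : ℝ → ℝ := (Icc (-M.r) 0).indicator fun ξ => M.a₁ ξ with ha
  set k : ℝ → ℝ := (Icc (-M.r) 0).indicator fun ξ => h.snd ξ with hk
  have ham : Measurable a := (measurable_L2 _).indicator measurableSet_Icc
  have hkm : Measurable k := (measurable_L2 _).indicator measurableSet_Icc
  have haI : Integrable a := (integrable_indicator_iff measurableSet_Icc).2 (integrable_L2 _)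
  have hkI : Integrable k := (integrable_indicator_iff measurableSet_Icc).2 (integrable_L2 _)
  have hk2 : MemLp k 2 := (memLp_indicator_iff_restrict measurableSet_Icc).2 (Lp.memLp _)
  have hk0 : ∀ᵐ ξ, 0 ≤ k ξ := by
    filter_upwards [(ae_restrict_iff' measurableSet_Icc).1 h1] with ξ hξ
    rw [hk, indicator_apply]
    split_ifs with h2
    exacts [hξ h2, le_rfl]
  have hkf : Measurable fun u => k (s - u) := by fun_prop
  -- The forcing `k (s - u)` is the initial memory arriving at `ξ = 0` at time `u`; together with
  -- the lag term it makes up the memory value at `ξ = 0`, which feeds the present component.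
  obtain ⟨y₁, hym₁, hy0₁, hys₁, ⟨C, hyC₁⟩, -, hy₁⟩ := exists_nonneg_delay_solution (T := M.T) M.a₀
    (f := fun u => k (s - u)) hr (measurable_L2 M.a₁)
    ((integrable_L2 M.a₁).mono_set Ioc_subset_Icc_self)
    (ae_restrict_of_ae_restrict_of_subset Ioc_subset_Icc_self ha₁) hkf
    (hkI.comp_sub_left s).integrableOn
    (ae_restrict_of_ae ((Measure.measurePreserving_sub_left (volume : Measure ℝ)
      s).quasiMeasurePreserving.ae hk0)) h0
  have hC : 0 ≤ C := (hy0₁ 0).trans (hyC₁ 0)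
  set y : ℝ → ℝ := (Iic M.T).indicator y₁ with hy
  have hym : Measurable y := hym₁.indicator measurableSet_Iic
  have hy0 : ∀ t, 0 ≤ y t := fun t => indicator_nonneg (fun _ _ => hy0₁ _) t
  have hyC : ∀ t, |y t| ≤ C := fun t => by
    rw [abs_of_nonneg (hy0 t)]
    exact (indicator_le_self' (fun _ _ => hy0₁ _) t).trans (hyC₁ t)
  have hys : ∀ t < s, y t = 0 := fun t ht => by
    rw [hy, indicator_apply, hys₁ t ht, ite_self]
  have hyT : ∀ t ≤ M.T, y t = y₁ t := fun t ht =>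
    indicator_of_mem (show t ∈ Iic M.T from ht) _
  have hyI : Integrable y := by
    have h2 : IntegrableOn y (Icc s M.T) :=
      Measure.integrableOn_of_bounded (M := C) measure_Icc_lt_top.ne hym.aestronglyMeasurable
        (ae_of_all _ hyC)
    refine (integrableOn_iff_integrable_of_support_subset fun t ht => ?_).1 h2
    by_contra h3
    refine ht ?_
    rcases lt_or_ge t s with h4 | h4
    · exact hys t h4
    · exact indicator_of_notMem (s := Iic M.T) (fun h5 => h3 ⟨h4, h5⟩) _
  have htr := memLp_transport (r := M.r) (s := s) ham hym haI hk2 hC hyC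
  choose hmem hnorm using htr
  set D₁ : ℝ → L2 M.r := fun u => (hmem u).toLp (transport s a k y u) with hD₁
  have hYeq : ∀ t ∈ Icc s M.T, ∫ τ in Iio t, y τ = ∫ u in s..t, y u := by
    intro t ht
    rw [intervalIntegral.integral_of_le ht.1, integral_Ioc_eq_integral_Ioo,
      ← integral_Ico_eq_integral_Ioo, ← Ici_inter_Iio, inter_comm,
      ← setIntegral_indicator measurableSet_Ici]
    congr 1
    funext τ
    by_cases hτ : s ≤ τ
    · exact (indicator_of_mem (show τ ∈ Ici s from hτ) _).symm
    · rw [indicator_of_notMem (by exact hτ), hys τ (not_le.1 hτ)]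
  have hyeq : ∀ t ∈ Icc s M.T, y t
      = h.fst + (M.a₀ * (∫ τ in Iio t, y τ) + ∫ u in s..t, transport s a k y u 0) := by
    intro t ht
    have hint : IntervalIntegrable (fun u => transport s a k y u 0) volume s t := by
      refine IntervalIntegrable.add (Integrable.intervalIntegrable ?_)
        (intervalIntegrable_memory ht.1 haI hyI 0)
      exact (hkI.comp_sub_left s).congr (ae_of_all _ fun u => by
        dsimp only; congr 1; ring)
    rw [hyT t ht.2, hy₁ t ht, hYeq t ht, ← intervalIntegral.integral_const_mul,
      ← intervalIntegral.integral_add (hyI.intervalIntegrable.const_mul _) hint]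
    congr 1
    rw [intervalIntegral.integral_of_le ht.1, intervalIntegral.integral_of_le ht.1]
    refine setIntegral_congr_fun measurableSet_Ioc fun u hu => ?_
    have huT : u ≤ M.T := hu.2.trans ht.2
    have h2 : ∫ τ in Iio u, y τ * a (0 - u + τ) = ∫ α in (-M.r)..0, M.a₁ α * y₁ (u + α) := by
      have h3 := (measurePreserving_add_left (volume : Measure ℝ) u).setIntegral_preimage_emb
        (measurableEmbedding_addLeft u) (fun τ => y τ * a (0 - u + τ)) (Iio u)
      rw [← h3, show (fun α => u + α) ⁻¹' Iio u = Iio 0 by ext; simp,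
        intervalIntegral.integral_of_le (by linarith), integral_Ioc_eq_integral_Ioo,
        ← integral_Ico_eq_integral_Ioo, ← Ici_inter_Iio, inter_comm,
        ← setIntegral_indicator measurableSet_Ici]
      refine setIntegral_congr_fun measurableSet_Iio fun α hα => ?_
      have hα' : α < 0 := hα
      simp only [ha, indicator, mem_Ici, mem_Icc, show 0 - u + (u + α) = α by ring, hα'.le,
        and_true, hyT (u + α) (by linarith)]
      split_ifs
      · ring
      · simp
    simp only [transport]
    rw [h2, hyT u huT, show 0 - u + s = s - u by ring]
    ring
  have hD₁m : StronglyMeasurable D₁ := stronglyMeasurable_toLp (measurable_transport ham hkm hym) hmem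
  refine ⟨fun u => WithLp.toLp 2 (y u, D₁ u), ?_, ?_, ?_, hy0, ?_⟩
  · refine (WithLp.prod_continuous_toLp 2 ℝ (L2 M.r)).comp_stronglyMeasurable ?_
    exact hym.stronglyMeasurable.prodMk hD₁m
  · refine ⟨_, fun t => (norm_state_le _).trans (add_le_add (hyC t) (hnorm t))⟩
  · have e1 : y s = h.fst := by
      rw [hyT s hs, hy₁ s ⟨le_rfl, hs⟩, intervalIntegral.integral_same, add_zero]
    have e2 : D₁ s = h.snd := by
      refine Lp.ext ?_
      filter_upwards [(hmem s).coeFn_toLp, ae_restrict_mem measurableSet_Icc] with ξ hξ hξm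
      rw [hξ, transport_initial hys, hk, indicator_of_mem hξm]
    change WithLp.toLp 2 (y s, D₁ s) = h
    rw [e1, e2]
    rfl
  · intro v w hvw t ht
    set Y : ℝ := ∫ τ in Iio t, y τ with hY
    -- This is forced by the second component of `A (∫ D) = D(t) - h`: `g` must be the derivative of
    -- the time-integrated memory.
    set g : L2 M.r := Y • M.a₁ + h.snd - D₁ t with hg
    have hgae : (fun ζ => g ζ) =ᵐ[volume.restrict (Icc (-M.r) 0)]
        fun ζ => Y * a ζ + k ζ - transport s a k y t ζ := by
      filter_upwards [Lp.coeFn_sub (Y • M.a₁ + h.snd) (D₁ t), Lp.coeFn_add (Y • M.a₁) h.snd,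
        Lp.coeFn_smul Y M.a₁, (hmem t).coeFn_toLp, ae_restrict_mem measurableSet_Icc]
        with ζ e1 e2 e3 e4 hζ
      rw [hg, e1, Pi.sub_apply, e2, Pi.add_apply, e3, Pi.smul_apply, smul_eq_mul, hD₁, e4, ha, hk,
        indicator_of_mem hζ, indicator_of_mem hζ]
    have hprim : ∀ ξ ∈ Icc (-M.r) 0,
        ∫ ζ in (-M.r)..ξ, g ζ = ∫ u in s..t, transport s a k y u ξ := by
      intro ξ hξ
      rw [intervalIntegral_congr_L2 hgae hξ, integral_transport ht.1 haI hkI hyI hys,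
        intervalIntegral.integral_of_le hξ.1, ← integral_Icc_eq_integral_Ioc, ← Ici_inter_Iic,
        inter_comm, ← setIntegral_indicator measurableSet_Ici]
      refine setIntegral_congr_fun measurableSet_Iic fun ζ hζ => ?_
      by_cases h2 : -M.r ≤ ζ
      · exact indicator_of_mem (show ζ ∈ Ici (-M.r) from h2) _
      · have hz : ∀ (φ : ℝ → ℝ) (η : ℝ), η ≤ ζ → (Icc (-M.r) 0).indicator φ η = 0 :=
          fun φ η hη => indicator_of_notMem (fun h3 => h2 (h3.1.trans hη)) _
        have e1 : ∫ τ in Iio t, y τ * a (ζ - t + τ) = 0 :=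
          setIntegral_eq_zero_of_forall_eq_zero fun τ hτ => by
            have hτ' : τ < t := hτ
            rw [ha, hz _ _ (by linarith), mul_zero]
        rw [indicator_of_notMem (by exact h2), transport, e1, ha, hk, hz _ _ le_rfl,
          hz _ _ le_rfl, hz _ _ (by linarith [ht.1])]
        simp
    have hr0 : (0 : ℝ) ∈ Icc (-M.r) 0 := ⟨by linarith, le_rfl⟩
    -- the memory component of the time integral of the trajectory
    have hJmem : MemLp (fun ξ => ∫ ζ in (-M.r)..ξ, g ζ) 2 (volume.restrict (Icc (-M.r) 0)) := by
      have hgI : Integrable ((Icc (-M.r) 0).indicator fun ξ => g ξ) :=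
        (integrable_indicator_iff measurableSet_Icc).2 (integrable_L2 g)
      have hcont : Continuous fun ξ => ∫ ζ in (-M.r)..ξ, (Icc (-M.r) 0).indicator (fun ξ => g ξ) ζ :=
        intervalIntegral.continuous_primitive (fun _ _ => hgI.intervalIntegrable) _
      obtain ⟨B, hB⟩ := isCompact_Icc.exists_bound_of_continuousOn
        (hcont.continuousOn (s := Icc (-M.r) 0))
      refine MemLp.ae_eq ?_ (MemLp.of_bound hcont.aestronglyMeasurable B
        ((ae_restrict_mem measurableSet_Icc).mono hB))
      filter_upwards [ae_restrict_mem measurableSet_Icc] with ξ hξ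
      refine intervalIntegral_congr_L2 ?_ hξ
      filter_upwards [ae_restrict_mem measurableSet_Icc] with ζ hζ using indicator_of_mem hζ _
    -- Only the time integral is placed in the domain; `D u` itself need not belong to it.
    have hgraph : ((WithLp.toLp 2 (Y, hJmem.toLp _), WithLp.toLp 2 (y t, D₁ t) - h) :
        State M.r × State M.r) ∈ generatorGraph M := by
      refine ⟨g, hJmem.coeFn_toLp, ?_, ?_⟩
      · rw [hprim 0 hr0]
        have := hyeq t ht
        change y t - h.fst = M.a₀ * Y + _
        linarith
      · change D₁ t - h.snd = Y • M.a₁ - g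
        rw [hg]
        abel
    have hadj := (Submodule.mem_adjoint_iff _ _).1 hvw _ _ hgraph
    rw [inner_sub_left] at hadj
    -- The pairing with `w` commutes with the time integral, by Fubini in the memory component.
    have hinner : ∫ u in s..t, inner ℝ (WithLp.toLp 2 (y u, D₁ u) : State M.r) w
        = inner ℝ (WithLp.toLp 2 (Y, hJmem.toLp _) : State M.r) w := by
      have e1 : ∀ (c : ℝ) (φ : ℝ → ℝ) (hφ : MemLp φ 2 (volume.restrict (Icc (-M.r) 0))),
          inner ℝ (WithLp.toLp 2 (c, hφ.toLp φ) : State M.r) w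
            = c * w.fst + ∫ ξ in Icc (-M.r) 0, w.snd ξ * φ ξ := by
        intro c φ hφ
        rw [WithLp.prod_inner_apply]
        change inner ℝ c w.fst + inner ℝ (hφ.toLp φ) w.snd = _
        rw [L2.inner_def]
        congr 1
        · simp [mul_comm]
        · refine integral_congr_ae ?_
          filter_upwards [hφ.coeFn_toLp] with ξ hξ
          rw [hξ]
          simp
      have e2 : IntervalIntegrable (fun u => ∫ ξ in Icc (-M.r) 0, w.snd ξ * transport s a k y u ξ)
          volume s t := by
        have e3 : ∀ u, ∫ ξ in Icc (-M.r) 0, w.snd ξ * transport s a k y u ξ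
            = inner ℝ (D₁ u) w.snd := by
          intro u
          rw [L2.inner_def]
          refine integral_congr_ae ?_
          filter_upwards [(hmem u).coeFn_toLp] with ξ hξ
          rw [hD₁, hξ]
          simp
        simp_rw [e3]
        rw [intervalIntegrable_iff_integrableOn_Ioc_of_le ht.1]
        obtain ⟨B, hB⟩ : ∃ B, ∀ u, ‖D₁ u‖ ≤ B := ⟨_, hnorm⟩
        refine Measure.integrableOn_of_bounded (M := B * ‖w.snd‖) measure_Ioc_lt_top.ne
          (hD₁m.inner stronglyMeasurable_const).aestronglyMeasurable (ae_of_all _ fun u => ?_)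
        exact (norm_inner_le_norm _ _).trans
          (mul_le_mul_of_nonneg_right (hB u) (norm_nonneg w.snd))
      simp_rw [hD₁, e1]
      rw [intervalIntegral.integral_add (hyI.intervalIntegrable.mul_const _) e2,
        intervalIntegral.integral_mul_const, ← hYeq t ht,
        integral_transport_mul ht.1 ham hym haI hkI hC hyC (integrable_L2 w.snd) measurableSet_Icc]
      congr 1
      refine setIntegral_congr_fun measurableSet_Icc fun ξ hξ => ?_
      simp only [hprim ξ hξ]
    rw [hinner]
    linarith

/-- Adds the deterministic homogeneous solution started at `x' - x`. Only the present component is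
compared, since the payoff sees nothing else of the state. -/
lemma IsWeakSolution.exists_ge {M : Model} {P : Measure Ω} {W : ℝ≥0 → Ω → ℝ}
    {z : ℝ → Ω → ℝ} (hz : IsAdmissible M P W z)
    (ha₁ : ∀ᵐ ξ ∂(volume.restrict (Icc (-M.r) 0)), 0 ≤ M.a₁ ξ) {s : ℝ} (hs : s ∈ Icc 0 M.T)
    {x x' : State M.r} (hx : StateLE x x') {Y : ℝ → Ω → State M.r}
    (hY : IsWeakSolution M P W s x z Y) :
    ∃ Y', IsWeakSolution M P W s x' z Y' ∧ ∀ ω, (Y M.T ω).fst ≤ (Y' M.T ω).fst := by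
  have h1 : ∀ᵐ ξ ∂(volume.restrict (Icc (-M.r) 0)), 0 ≤ (x' - x).snd ξ := by
    filter_upwards [hx.2, Lp.coeFn_sub x'.snd x.snd] with ξ h1 h2
    change 0 ≤ (x'.snd - x.snd : L2 M.r) ξ
    rw [h2]
    exact sub_nonneg.2 h1
  obtain ⟨D, hDm, ⟨C, hDC⟩, hDs, hD0, hD⟩ :=
    exists_homogeneous_weakSolution ha₁ s (h := x' - x) (sub_nonneg.2 hx.1) h1 hs.2
  have hDI : IntegrableOn D (Icc s M.T) :=
    Measure.integrableOn_of_bounded measure_Icc_lt_top.ne hDm.aestronglyMeasurable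
      (ae_of_all _ hDC)
  refine ⟨fun t ω => Y t ω + D t, ⟨fun t ht => (hY.adapted t ht).add stronglyMeasurable_const,
    hY.measurable.add (hDm.comp_measurable (by fun_prop)), ?_, ?_, ?_⟩,
    fun ω => le_add_of_nonneg_right (hD0 M.T)⟩
  · filter_upwards [hY.integrable] with ω hω using hω.add hDI
  · filter_upwards [hY.initial] with ω hω
    rw [hω, hDs]
    abel
  · intro v w hvw t ht
    filter_upwards [hY.integrable, hY.equation v w hvw t ht] with ω hω he
    have hsub : Ioc s t ⊆ Icc s M.T := fun u hu => ⟨hu.1.le, hu.2.trans ht.2⟩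
    have hYi : IntegrableOn (fun u => inner ℝ (Y u ω) w) (Ioc s t) :=
      Integrable.inner_const (hω.mono_set hsub) w
    have hDi : IntegrableOn (fun u => inner ℝ (D u) w) (Ioc s t) :=
      Integrable.inner_const (hDI.mono_set hsub) w
    have hzi : IntegrableOn (fun u => inner ℝ (controlOp M (z u ω)) v) (Ioc s t) := by
      -- Linearity of the control operator makes this pairing a constant multiple of the bounded
      -- control path, hence integrable, as splitting the time integral requires.
      have h2 : ∀ c : ℝ, inner ℝ (controlOp M c) v = c * inner ℝ (controlOp M 1) v := by
        intro c
        rw [← real_inner_smul_left]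
        congr 1
        refine (WithLp.ofLp_injective 2) (Prod.ext ?_ ?_)
        · change M.b₀ * c = c * (M.b₀ * 1)
          ring
        · change c • M.b₁ = c • ((1 : ℝ) • M.b₁)
          rw [one_smul]
      refine IntegrableOn.congr_fun (f := fun u => z u ω * inner ℝ (controlOp M 1) v) ?_
        (fun u _ => (h2 (z u ω)).symm) measurableSet_Ioc
      exact ((hz.integrableOn_path hs.1 ω).mono_set hsub).mul_const _
    have key : ∫ u in s..t, (inner ℝ (Y u ω + D u) w + inner ℝ (controlOp M (z u ω)) v)
        = (∫ u in s..t, (inner ℝ (Y u ω) w + inner ℝ (controlOp M (z u ω)) v))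
          + ∫ u in s..t, inner ℝ (D u) w := by
      rw [← intervalIntegral.integral_add]
      · congr 1
        funext u
        rw [inner_add_left]
        ring
      · rw [intervalIntegrable_iff_integrableOn_Ioc_of_le ht.1]
        exact hYi.add hzi
      · rwa [intervalIntegrable_iff_integrableOn_Ioc_of_le ht.1]
    rw [key, inner_add_left, he, hD v w hvw t ht, inner_sub_left]
    ring

theorem value_mono {M : Model} (P : Measure Ω) (W : ℝ≥0 → Ω → ℝ)
    (ha₁ : ∀ᵐ ξ ∂(volume.restrict (Icc (-M.r) 0)), 0 ≤ M.a₁ ξ) (hφ₀ : Monotone M.φ₀) {s : ℝ}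
    (hs : s ∈ Icc 0 M.T) {x x' : State M.r} (hx : StateLE x x') :
    value M P W s x ≤ value M P W s x' := by
  refine iSup₂_le fun z hz => iSup₂_le fun Y hY => ?_
  obtain ⟨Y', hY', hle⟩ := hY.exists_ge hz ha₁ hs hx
  exact (payoff_mono hφ₀ P s z hle).trans
    (le_iSup₂_of_le z hz (le_iSup₂_of_le Y' hY' le_rfl))

end Advertising

theorem proposition3p6 (M : Advertising.Model)
    {Ω : Type*} [MeasurableSpace Ω] (P : Measure Ω) [IsProbabilityMeasure P]
    (W : ℝ≥0 → Ω → ℝ) (hWm : ∀ t, Measurable (W t)) (hW : IsBrownianReal W P)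
    (ha₁ : ∀ᵐ ξ ∂(volume.restrict (Icc (-M.r) 0)), 0 ≤ M.a₁ ξ)
    (hφ₀ : Monotone M.φ₀)
    (s : ℝ) (hs : s ∈ Icc 0 M.T)
    (x x' : Advertising.State M.r) (hx : Advertising.StateLE x x') :
    Advertising.value M P W s x ≤ Advertising.value M P W s x' ∧
      ∀ δ : Advertising.L2 M.r,
        Advertising.delayValue M P W δ s x ≤ Advertising.delayValue M P W δ s x' := by
  exact ⟨Advertising.value_mono P W ha₁ hφ₀ hs hx,
    fun δ => Advertising.delayValue_mono P W ha₁ hφ₀ hs hx δ⟩
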